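/- Let $a,b\in\mathbb{C}$ be arbitrary. Let $\operatorname{Ai},\operatorname{Bi}$ be the Airy functions, regarded as entire functions on $\mathbb{C}$, and let $${}_2F_2\left(\begin{matrix}\alpha_1,\alpha_2\\ \beta_1,\beta_2\end{matrix}\,\middle|\,x\right)=\sum_{n\ge0}\frac{(\alpha_1)_n(\alpha_2)_n}{(\beta_1)_n(\beta_2)_n}\frac{x^n}{n!},\qquad (\alpha)_n=\alpha(\alpha+1)\cdots(\alpha+n-1).$$ (i) Put $t_1=2at-a(a-b)^2(a+2b)$ and $t_2=2bt-b(a-b)^2(2a+b)$. Then the following integral converges absolutely and $$\int_{\mathbb{R}}e^{-t^2}\{\operatorname{Ai}(t_1)\operatorname{Bi}(t_2)+\operatorname{Ai}(t_2)\operatorname{Bi}(t_1)\}\,dt=\frac{2}{12^{1/3}}\exp\left(-\tfrac13(a-b)^4(a^2+4ab+b^2)\right)$$ $$\times\left\{\frac{1}{\Gamma(\frac56)}\,{}_2F_2\left(\begin{matrix}\frac1{12},\frac7{12}\\ \frac13,\frac23\end{matrix}\,\middle|\,\tfrac{64}{3}(ab)^3\right)-\frac{2ab}{12^{1/3}\,\Gamma(\frac76)}\,{}_2F_2\left(\begin{matrix}\frac5{12},\frac{11}{12}\\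 \frac23,\frac43\end{matrix}\,\middle|\,\tfrac{64}{3}(ab)^3\right)\right\}.$$ (ii) Put $t_3=2at-a(a+b)(a^2-ab+2b^2)$ and $t_4=2bt-b(a+b)(2a^2-ab+b^2)$. Then the following integral converges absolutely and $$\int_{\mathbb{R}}e^{-t^2}\{\operatorname{Ai}(t_3)\operatorname{Bi}(t_4)+\operatorname{Ai}(t_4)\operatorname{Bi}(t_3)\}\,dt=\frac{2}{12^{1/3}}\exp\left(-\tfrac13\left[(a^3+b^3)^2+3a^2b^2(a+b)^2\right]\right)$$ $$\times\left\{\frac{1}{\Gamma(\frac56)}\,{}_2F_2\left(\begin{matrix}\frac16,\frac12\\ \frac13,\frac23\end{matrix}\,\middle|\,\tfrac{16}{3}(ab)^3\right)-\frac{2ab}{12^{1/3}\,\Gamma(\frac76)}\,{}_2F_2\left(\begin{matrix}\frac12,\frac56\\ \frac23,\frac43\end{matrix}\,\middle|\,\tfrac{16}{3}(ab)^3\right)\right\}.$$ -/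

import Mathlib

open scoped Nat

noncomputable section

/-- The first Airy atom `f(z) = ∑ₖ (1/3)ₖ 3ᵏ z³ᵏ / (3k)!`: the entire solution of `w'' = z w`
with `w(0) = 1`, `w'(0) = 0`. -/
def airyAtomF (z : ℂ) : ℂ :=
  ∑' k : ℕ, (ascPochhammer ℂ k).eval (1 / 3) * 3 ^ k * z ^ (3 * k) / ((3 * k)! : ℂ)

/-- The second Airy atom `g(z) = ∑ₖ (2/3)ₖ 3ᵏ z³ᵏ⁺¹ / (3k+1)!`: the entire solution of `w'' = z w`
with `w(0) = 0`, `w'(0) = 1`. -/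
def airyAtomG (z : ℂ) : ℂ :=
  ∑' k : ℕ, (ascPochhammer ℂ k).eval (2 / 3) * 3 ^ k * z ^ (3 * k + 1) / ((3 * k + 1)! : ℂ)

/-- `c₁ = 3^(-2/3) / Γ(2/3) = Ai(0)`. -/
def airyC₁ : ℝ := (3 : ℝ) ^ (-(2 / 3) : ℝ) / Real.Gamma (2 / 3)

/-- `c₂ = 3^(-1/3) / Γ(1/3) = -Ai'(0)`. -/
def airyC₂ : ℝ := (3 : ℝ) ^ (-(1 / 3) : ℝ) / Real.Gamma (1 / 3)

/-- The Airy function `Ai` as an entire function on `ℂ`. -/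
def airyAi (z : ℂ) : ℂ := airyC₁ * airyAtomF z - airyC₂ * airyAtomG z

/-- The Airy function `Bi` as an entire function on `ℂ`. -/
def airyBi (z : ℂ) : ℂ := (√3 : ℝ) * (airyC₁ * airyAtomF z + airyC₂ * airyAtomG z)

/-- The symmetrised product `Ai(u) Bi(v) + Ai(v) Bi(u)`. -/
def airyCross (u v : ℂ) : ℂ := airyAi u * airyBi v + airyAi v * airyBi u

/-- The generalized hypergeometric function
`₂F₂(a₁, a₂; b₁, b₂ | z) = ∑ₙ (a₁)ₙ (a₂)ₙ / ((b₁)ₙ (b₂)ₙ) zⁿ / n!`,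
for lower parameters `b₁`, `b₂` that are not non-positive integers. -/
def hypergeom22 (a₁ a₂ b₁ b₂ z : ℂ) : ℂ :=
  ∑' n : ℕ, (ascPochhammer ℂ n).eval a₁ * (ascPochhammer ℂ n).eval a₂ /
    ((ascPochhammer ℂ n).eval b₁ * (ascPochhammer ℂ n).eval b₂) * (z ^ n / (n ! : ℂ))

end

/-! In the symmetrised product the mixed terms cancel (`airyCross_eq`), so it is a combination of
`f(u) f(v)` and `g(u) g(v)`, where `f`, `g` are the two Airy atoms. It therefore suffices to
integrate `F(2at+p) F(2bt+q)` against `e^{-t²}` for one Airy solution `F` at a time.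

The quartic shifts `p`, `q` and an exponential prefactor are built so that the weighted integral
depends on `ab` alone. When `(a, b)` moves with `ab` fixed, the Airy equation turns the derivative
of the integrand into an exact `t`-derivative, whose integral vanishes
(`integral_directional_eq_zero`, `integral_const_along`). Both families in the theorem have these
shifts, with a free multiple `k` of `(ab)²`: `k = 3` for the first, `k = -1` for the second. So `(a,
b)` can be moved to `(d, εd)` with `ε d² = ab` and `ε = ±1`, where `k = 1 + 2ε` makes both shifts
vanish (`integral_mul_eq`).

There the integral of `F(2dt) F(2εdt)` is computed term by term. The product satisfies a linear ODE,
so its Taylor coefficients obey a recurrence; together with the recurrence for Gaussian moments this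
gives a two-term recurrence of step six with hypergeometric ratio. Only one residue class mod 6
survives, and the sum is a `₂F₂`. The reflection and duplication formulas for `Γ` supply the
constants. All analytic steps rest on the Airy atoms having order 3/2, below the order 2 of the
Gaussian. -/

/-! ### Sub-Gaussian growth and integrability against `e^{-t²}`. -/

/-- Growth of order at most two and minimal type:
`F` is dominated by `exp (δ ‖z‖²)` for every `δ > 0`. -/
def SubGaussian (F : ℂ → ℂ) : Prop :=
  ∀ δ : ℝ, 0 < δ → ∃ C : ℝ, ∀ z, ‖F z‖ ≤ C * Real.exp (δ * ‖z‖ ^ 2)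

/-- Cauchy's estimate on unit circles. Starting from `δ / 2` pays for `‖w‖² ≤ 2‖z‖² + 2` on the
circle. -/
lemma SubGaussian.deriv {F : ℂ → ℂ} (hd : Differentiable ℂ F) (h : SubGaussian F) :
    SubGaussian (deriv F) := by
  intro δ hδ
  obtain ⟨C, hC⟩ := h (δ / 2) (by positivity)
  have hC0 : 0 ≤ C := by
    have := (norm_nonneg _).trans (hC 0)
    simpa using this
  refine ⟨C * Real.exp δ, fun z => ?_⟩
  have key := Complex.norm_deriv_le_of_forall_mem_sphere_norm_le (c := z) (R := 1) (f := F)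
    (C := C * Real.exp δ * Real.exp (δ * ‖z‖ ^ 2)) one_pos hd.diffContOnCl ?_
  · simpa using key
  · intro w hw
    refine (hC w).trans ?_
    rw [mul_assoc, ← Real.exp_add]
    gcongr
    have h1 : ‖w‖ ≤ ‖z‖ + 1 := by
      have h2 : ‖w - z‖ = 1 := by simpa [dist_eq_norm] using hw
      calc ‖w‖ = ‖z + (w - z)‖ := by ring_nf
        _ ≤ _ := (norm_add_le _ _).trans (by rw [h2])
    have h3 : ‖w‖ ^ 2 ≤ 2 * ‖z‖ ^ 2 + 2 := by
      nlinarith [norm_nonneg w, norm_nonneg z, sq_nonneg (‖z‖ - 1)]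
    nlinarith

/-- Minimal type is what allows an arbitrary slope `R`: `δ` is chosen after `R`. The exponent `t²/4`
leaves room for a linear factor in `t` before the Gaussian is used up. -/
lemma SubGaussian.exists_norm_mul_le {F G : ℂ → ℂ} (hF : SubGaussian F) (hG : SubGaussian G)
    (R : ℝ) : ∃ C : ℝ, 0 ≤ C ∧ ∀ (t : ℝ) (u v : ℂ), ‖u‖ ≤ R * (1 + |t|) →
      ‖v‖ ≤ R * (1 + |t|) → ‖F u * G v‖ ≤ C * Real.exp (t ^ 2 / 4) := by
  -- Since `‖u‖² ≤ (R² + 1)(2 + 2t²)`, this gives each factor exponent at most `1/8 + t²/8`.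
  set δ : ℝ := 1 / (16 * (R ^ 2 + 1)) with hδ
  have hδ0 : 0 < δ := by positivity
  obtain ⟨C₁, h₁⟩ := hF δ hδ0
  obtain ⟨C₂, h₂⟩ := hG δ hδ0
  have hC₁ : 0 ≤ C₁ := by simpa using (norm_nonneg _).trans (h₁ 0)
  have hC₂ : 0 ≤ C₂ := by simpa using (norm_nonneg _).trans (h₂ 0)
  have aux : ∀ (t : ℝ) (u : ℂ), ‖u‖ ≤ R * (1 + |t|) → δ * ‖u‖ ^ 2 ≤ 1 / 8 + t ^ 2 / 8 := by
    intro t u hu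
    have h3 : ‖u‖ ^ 2 ≤ (R * (1 + |t|)) ^ 2 := pow_le_pow_left₀ (norm_nonneg _) hu 2
    have h4 : (1 + |t|) ^ 2 ≤ 2 + 2 * t ^ 2 := by
      nlinarith [sq_nonneg (|t| - 1), sq_abs t]
    have h5 : ‖u‖ ^ 2 ≤ (R ^ 2 + 1) * (2 + 2 * t ^ 2) := by
      nlinarith [sq_nonneg R, sq_nonneg t]
    calc δ * ‖u‖ ^ 2 ≤ δ * ((R ^ 2 + 1) * (2 + 2 * t ^ 2)) := by gcongr
      _ = 1 / 8 + t ^ 2 / 8 := by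
        rw [hδ]
        field_simp
        ring
  refine ⟨C₁ * C₂ * Real.exp (1 / 4), by positivity, fun t u v hu hv => ?_⟩
  rw [norm_mul]
  calc ‖F u‖ * ‖G v‖ ≤ (C₁ * Real.exp (δ * ‖u‖ ^ 2)) * (C₂ * Real.exp (δ * ‖v‖ ^ 2)) := by
        gcongr
        · exact h₁ u
        · exact h₂ v
    _ ≤ (C₁ * Real.exp (1 / 8 + t ^ 2 / 8)) * (C₂ * Real.exp (1 / 8 + t ^ 2 / 8)) := by
        gcongr
        · exact aux t u hu
        · exact aux t v hv
    _ = C₁ * C₂ * Real.exp (1 / 4) * Real.exp (t ^ 2 / 4) := by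
        have : Real.exp (1 / 8 + t ^ 2 / 8) * Real.exp (1 / 8 + t ^ 2 / 8)
            = Real.exp (1 / 4) * Real.exp (t ^ 2 / 4) := by
          rw [← Real.exp_add, ← Real.exp_add]
          ring_nf
        linear_combination (C₁ * C₂) * this

/-- Absorbs the linear factors produced by differentiating the arguments; with the previous bound
the total exponent is `t²/2`. -/
lemma one_add_abs_le_two_mul_exp (t : ℝ) : 1 + |t| ≤ 2 * Real.exp (t ^ 2 / 4) := by
  have h := Real.add_one_le_exp (t ^ 2 / 4)
  nlinarith [sq_nonneg (|t| / 2 - 1), sq_abs t, sq_nonneg t]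

lemma norm_cexp_neg_sq (t : ℝ) : ‖Complex.exp (-(t : ℂ) ^ 2)‖ = Real.exp (-t ^ 2) := by
  rw [Complex.norm_exp]
  congr 1
  norm_cast

lemma integrable_exp_neg_sq_div_two (C : ℝ) :
    MeasureTheory.Integrable fun t : ℝ => C * Real.exp (-(1 / 2) * t ^ 2) :=
  (integrable_exp_neg_mul_sq (by norm_num)).const_mul C

lemma norm_cexp_neg_sq_mul_le {t C : ℝ} {w : ℂ} (h : ‖w‖ ≤ C * Real.exp (t ^ 2 / 2)) :
    ‖Complex.exp (-(t : ℂ) ^ 2) * w‖ ≤ C * Real.exp (-(1 / 2) * t ^ 2) := by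
  rw [norm_mul, norm_cexp_neg_sq]
  calc Real.exp (-t ^ 2) * ‖w‖ ≤ Real.exp (-t ^ 2) * (C * Real.exp (t ^ 2 / 2)) := by gcongr
    _ = C * Real.exp (-(1 / 2) * t ^ 2) := by
      rw [mul_left_comm, ← Real.exp_add]
      ring_nf

lemma integrable_cexp_neg_sq_mul {h : ℝ → ℂ} (hc : Continuous h) {C : ℝ}
    (hb : ∀ t, ‖h t‖ ≤ C * Real.exp (t ^ 2 / 2)) :
    MeasureTheory.Integrable fun t : ℝ => Complex.exp (-(t : ℂ) ^ 2) * h t :=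
  (integrable_exp_neg_sq_div_two C).mono' (by fun_prop)
    (.of_forall fun t => norm_cexp_neg_sq_mul_le (hb t))

lemma SubGaussian.integrable_mul {F G : ℂ → ℂ} (hF : SubGaussian F) (hFc : Continuous F)
    (hG : SubGaussian G) (hGc : Continuous G) (a p b q : ℂ) :
    MeasureTheory.Integrable fun t : ℝ =>
      Complex.exp (-(t : ℂ) ^ 2) * (F (a * t + p) * G (b * t + q)) := by
  obtain ⟨C, hC0, hC⟩ := hF.exists_norm_mul_le hG
    (‖a‖ + ‖p‖ + ‖b‖ + ‖q‖)
  have aux : ∀ (x y : ℂ) (t : ℝ), ‖x * t + y‖ ≤ (‖x‖ + ‖y‖) * (1 + |t|) := by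
    intro x y t
    refine (norm_add_le _ _).trans ?_
    rw [norm_mul, Complex.norm_real, Real.norm_eq_abs]
    nlinarith [norm_nonneg x, norm_nonneg y, abs_nonneg t,
      mul_nonneg (norm_nonneg y) (abs_nonneg t)]
  refine integrable_cexp_neg_sq_mul (by fun_prop) (C := C) fun t => ?_
  refine (hC t _ _ ((aux a p t).trans (mul_le_mul_of_nonneg_right ?_ (by positivity)))
    ((aux b q t).trans (mul_le_mul_of_nonneg_right ?_ (by positivity)))).trans ?_
  · linarith [norm_nonneg b, norm_nonneg q]
  · linarith [norm_nonneg a, norm_nonneg p]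
  · gcongr
    linarith

/-! ### Airy solutions: the weighted integral is a function of `ab`. -/

/-- An entire solution of the Airy equation `F'' = z F`, with its derivative `F'`,
both of sub-Gaussian growth. -/
structure IsAirySolution (F F' : ℂ → ℂ) : Prop where
  hasDerivAt : ∀ z, HasDerivAt F (F' z) z
  hasDerivAt' : ∀ z, HasDerivAt F' (z * F z) z
  subGaussian : SubGaussian F
  subGaussian' : SubGaussian F'

namespace IsAirySolution

variable {F F' G G' : ℂ → ℂ}

lemma continuous (h : IsAirySolution F F') : Continuous F :=
  continuous_iff_continuousAt.2 fun z => (h.hasDerivAt z).continuousAt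

lemma continuous' (h : IsAirySolution F F') : Continuous F' :=
  continuous_iff_continuousAt.2 fun z => (h.hasDerivAt' z).continuousAt

/-- Differentiation under the Gaussian integral along a curve of affine arguments. -/
lemma hasDerivAt_integral (hF : IsAirySolution F F') (hG : IsAirySolution G G')
    {a a' p p' b b' q q' e e' : ℝ → ℂ}
    (ha : ∀ s, HasDerivAt a (a' s) s) (hp : ∀ s, HasDerivAt p (p' s) s)
    (hb : ∀ s, HasDerivAt b (b' s) s) (hq : ∀ s, HasDerivAt q (q' s) s)
    (he : ∀ s, HasDerivAt e (e' s) s)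
    (ha' : Continuous a') (hp' : Continuous p') (hb' : Continuous b') (hq' : Continuous q')
    (he' : Continuous e') (s : ℝ) :
    MeasureTheory.Integrable (fun t : ℝ => Complex.exp (-(t : ℂ) ^ 2) *
      (e' s * (F (a s * t + p s) * G (b s * t + q s)) +
        e s * ((a' s * t + p' s) * (F' (a s * t + p s) * G (b s * t + q s)) +
          (b' s * t + q' s) * (F (a s * t + p s) * G' (b s * t + q s))))) ∧
    HasDerivAt (fun s : ℝ => ∫ t : ℝ, Complex.exp (-(t : ℂ) ^ 2) *
        (e s * (F (a s * t + p s) * G (b s * t + q s))))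
      (∫ t : ℝ, Complex.exp (-(t : ℂ) ^ 2) *
        (e' s * (F (a s * t + p s) * G (b s * t + q s)) +
          e s * ((a' s * t + p' s) * (F' (a s * t + p s) * G (b s * t + q s)) +
            (b' s * t + q' s) * (F (a s * t + p s) * G' (b s * t + q s))))) s := by
  have hFc := hF.continuous
  have hGc := hG.continuous
  have hFc' := hF.continuous'
  have hGc' := hG.continuous'
  have hac : Continuous a := continuous_iff_continuousAt.2 fun z => (ha z).continuousAt
  have hbc : Continuous b := continuous_iff_continuousAt.2 fun z => (hb z).continuousAt
  have hpc : Continuous p := continuous_iff_continuousAt.2 fun z => (hp z).continuousAt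
  have hqc : Continuous q := continuous_iff_continuousAt.2 fun z => (hq z).continuousAt
  have hec : Continuous e := continuous_iff_continuousAt.2 fun z => (he z).continuousAt
  -- One constant controls all parameters and their derivatives near `s`, so the dominating function
  -- is uniform in the parameter.
  obtain ⟨R, hR⟩ := (isCompact_closedBall s 1).exists_bound_of_continuousOn
    (f := fun s => ‖a s‖ + ‖p s‖ + ‖b s‖ + ‖q s‖ + ‖e s‖ +
      (‖a' s‖ + ‖p' s‖ + ‖b' s‖ + ‖q' s‖ + ‖e' s‖)) (by fun_prop)
  have hR' : ∀ r ∈ Metric.closedBall s 1, ‖a r‖ + ‖p r‖ + ‖b r‖ + ‖q r‖ + ‖e r‖ +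
      (‖a' r‖ + ‖p' r‖ + ‖b' r‖ + ‖q' r‖ + ‖e' r‖) ≤ R := fun r hr =>
    (le_abs_self _).trans (hR r hr)
  have hR0 : 0 ≤ R := (norm_nonneg _).trans (hR s (by simp))
  have aux : ∀ (x y : ℂ) (t : ℝ), ‖x‖ + ‖y‖ ≤ R → ‖x * t + y‖ ≤ R * (1 + |t|) := by
    intro x y t hxy
    refine (norm_add_le _ _).trans ?_
    rw [norm_mul, Complex.norm_real, Real.norm_eq_abs]
    nlinarith [norm_nonneg x, norm_nonneg y, abs_nonneg t,
      mul_nonneg (norm_nonneg y) (abs_nonneg t), mul_le_mul_of_nonneg_right hxy (abs_nonneg t)]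
  obtain ⟨C, hC0, hC⟩ := hF.subGaussian.exists_norm_mul_le hG.subGaussian R
  obtain ⟨C₁, hC₁0, hC₁⟩ := hF.subGaussian'.exists_norm_mul_le hG.subGaussian R
  obtain ⟨C₂, hC₂0, hC₂⟩ := hF.subGaussian.exists_norm_mul_le hG.subGaussian' R
  refine hasDerivAt_integral_of_dominated_loc_of_deriv_le
    (F' := fun s (t : ℝ) => Complex.exp (-(t : ℂ) ^ 2) *
      (e' s * (F (a s * t + p s) * G (b s * t + q s)) +
        e s * ((a' s * t + p' s) * (F' (a s * t + p s) * G (b s * t + q s)) +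
          (b' s * t + q' s) * (F (a s * t + p s) * G' (b s * t + q s)))))
    (bound := fun t => (R * (2 * C) + R * (2 * R * C₁ + 2 * R * C₂)) *
      Real.exp (-(1 / 2) * t ^ 2)) (Metric.closedBall_mem_nhds s one_pos) ?_ ?_ ?_ ?_ ?_ ?_
  · exact .of_forall fun r => Continuous.aestronglyMeasurable (by fun_prop)
  · have := (hF.subGaussian.integrable_mul hFc hG.subGaussian hGc (a s) (p s) (b s) (q s)).const_mul (e s)
    refine this.congr (.of_forall fun t => ?_)
    simp only
    ring
  · exact Continuous.aestronglyMeasurable (by fun_prop)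
  · refine .of_forall fun t r hr => norm_cexp_neg_sq_mul_le ?_
    have hr' := hR' r hr
    have n1 := norm_nonneg (a r)
    have n2 := norm_nonneg (p r)
    have n3 := norm_nonneg (b r)
    have n4 := norm_nonneg (q r)
    have n5 := norm_nonneg (e r)
    have n6 := norm_nonneg (a' r)
    have n7 := norm_nonneg (p' r)
    have n8 := norm_nonneg (b' r)
    have n9 := norm_nonneg (q' r)
    have n10 := norm_nonneg (e' r)
    have hu := aux (a r) (p r) t (by linarith)
    have hv := aux (b r) (q r) t (by linarith)
    have hu' := aux (a' r) (p' r) t (by linarith)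
    have hv' := aux (b' r) (q' r) t (by linarith)
    have hE : (1 : ℝ) ≤ Real.exp (t ^ 2 / 4) := Real.one_le_exp (by positivity)
    have hT := one_add_abs_le_two_mul_exp t
    have hexp : Real.exp (t ^ 2 / 2) = Real.exp (t ^ 2 / 4) * Real.exp (t ^ 2 / 4) := by
      rw [← Real.exp_add]
      ring_nf
    have b0 : ‖e' r * (F (a r * t + p r) * G (b r * t + q r))‖ ≤
        R * (2 * C) * Real.exp (t ^ 2 / 2) := by
      rw [norm_mul, hexp]
      calc _ ≤ R * (C * Real.exp (t ^ 2 / 4)) := by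
            gcongr
            · linarith
            · exact hC t _ _ hu hv
        _ ≤ R * (C * (Real.exp (t ^ 2 / 4) * (2 * Real.exp (t ^ 2 / 4)))) := by
            gcongr
            nlinarith
        _ = _ := by ring
    have b1 : ‖(a' r * t + p' r) * (F' (a r * t + p r) * G (b r * t + q r))‖ ≤
        2 * R * C₁ * Real.exp (t ^ 2 / 2) := by
      rw [norm_mul, hexp]
      calc _ ≤ R * (2 * Real.exp (t ^ 2 / 4)) * (C₁ * Real.exp (t ^ 2 / 4)) := by
            gcongr
            · exact hu'.trans (by gcongr)
            · exact hC₁ t _ _ hu hv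
        _ = _ := by ring
    have b2 : ‖(b' r * t + q' r) * (F (a r * t + p r) * G' (b r * t + q r))‖ ≤
        2 * R * C₂ * Real.exp (t ^ 2 / 2) := by
      rw [norm_mul, hexp]
      calc _ ≤ R * (2 * Real.exp (t ^ 2 / 4)) * (C₂ * Real.exp (t ^ 2 / 4)) := by
            gcongr
            · exact hv'.trans (by gcongr)
            · exact hC₂ t _ _ hu hv
        _ = _ := by ring
    refine (norm_add_le _ _).trans ?_
    refine (add_le_add b0 (?_ : _ ≤ R * ((2 * R * C₁ + 2 * R * C₂) *
      Real.exp (t ^ 2 / 2)))).trans_eq (by ring)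
    rw [norm_mul]
    gcongr
    · linarith
    · refine (norm_add_le _ _).trans ?_
      exact (add_le_add b1 b2).trans_eq (by ring)
  · exact integrable_exp_neg_sq_div_two _
  · refine .of_forall fun t r _ => ?_
    have hA : HasDerivAt (fun r => a r * t + p r) (a' r * t + p' r) r :=
      ((ha r).mul_const _).add (hp r)
    have hB : HasDerivAt (fun r => b r * t + q r) (b' r * t + q' r) r :=
      ((hb r).mul_const _).add (hq r)
    have h1 := (hF.hasDerivAt (a r * t + p r)).comp r hA
    have h2 := (hG.hasDerivAt (b r * t + q r)).comp r hB
    refine (((he r).mul (h1.mul h2)).const_mul (Complex.exp (-(t : ℂ) ^ 2))).congr_deriv ?_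
    simp only [Function.comp, Pi.mul_apply]
    ring

end IsAirySolution

namespace IsAirySolution

variable {F F' G G' : ℂ → ℂ}

/-- If `b * da + a * db = 0`, the derivative of the weighted Gaussian integral
along `(da, db)` is the integral of a total derivative, hence vanishes. -/
lemma integral_directional_eq_zero (hF : IsAirySolution F F') (hG : IsAirySolution G G')
    (a b da db p q : ℂ) (h : da * b + a * db = 0) :
    ∫ t : ℝ, Complex.exp (-(t : ℂ) ^ 2) *
      (-2 * (a * da * p + b * db * q) * (F (2 * a * t + p) * G (2 * b * t + q)) +
        ((2 * da * t - 4 * a * (a ^ 2 * da + b ^ 2 * db)) *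
            (F' (2 * a * t + p) * G (2 * b * t + q)) +
          (2 * db * t - 4 * b * (a ^ 2 * da + b ^ 2 * db)) *
            (F (2 * a * t + p) * G' (2 * b * t + q)))) = 0 := by
  set κ : ℂ := a ^ 2 * da + b ^ 2 * db with hκ
  have hFc := hF.continuous
  have hGc := hG.continuous
  have hFc' := hF.continuous'
  have hGc' := hG.continuous'
  -- The explicit primitive. Differentiating the `da` and `db` terms yields an `F' G'` term
  -- proportional to `da * b + a * db`, zero by `h`, and a term `-4κt F G`, which the `2κ F G`
  -- summand cancels against the derivative of the Gaussian.
  have hd : ∀ t : ℝ, HasDerivAt (fun t : ℝ => Complex.exp (-(t : ℂ) ^ 2) *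
      (-(da * (F' (2 * a * t + p) * G (2 * b * t + q)) +
        db * (F (2 * a * t + p) * G' (2 * b * t + q)) +
        2 * κ * (F (2 * a * t + p) * G (2 * b * t + q)))))
      (Complex.exp (-(t : ℂ) ^ 2) *
      (-2 * (a * da * p + b * db * q) * (F (2 * a * t + p) * G (2 * b * t + q)) +
        ((2 * da * t - 4 * a * κ) *
            (F' (2 * a * t + p) * G (2 * b * t + q)) +
          (2 * db * t - 4 * b * κ) *
            (F (2 * a * t + p) * G' (2 * b * t + q))))) t := by
    intro t
    have hA : HasDerivAt (fun t : ℂ => 2 * a * t + p) (2 * a) (t : ℂ) := by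
      simpa using ((hasDerivAt_id (t : ℂ)).const_mul (2 * a)).add_const p
    have hB : HasDerivAt (fun t : ℂ => 2 * b * t + q) (2 * b) (t : ℂ) := by
      simpa using ((hasDerivAt_id (t : ℂ)).const_mul (2 * b)).add_const q
    have h1 := (hF.hasDerivAt (2 * a * t + p)).comp (t : ℂ) hA
    have h2 := (hG.hasDerivAt (2 * b * t + q)).comp (t : ℂ) hB
    have h1' := (hF.hasDerivAt' (2 * a * t + p)).comp (t : ℂ) hA
    have h2' := (hG.hasDerivAt' (2 * b * t + q)).comp (t : ℂ) hB
    have he : HasDerivAt (fun t : ℂ => Complex.exp (-t ^ 2))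
        (Complex.exp (-(t : ℂ) ^ 2) * (-(2 * t))) (t : ℂ) := by
      simpa using ((hasDerivAt_id (t : ℂ)).pow 2).neg.cexp
    have := (he.mul ((((h1'.mul h2).const_mul da).add
      ((h1.mul h2').const_mul db)).add ((h1.mul h2).const_mul (2 * κ))).neg).comp_ofReal
    refine this.congr_deriv ?_
    simp only [Function.comp, Pi.mul_apply, Pi.add_apply, Pi.neg_apply]
    simp only [hκ]
    linear_combination (-2 * Complex.exp (-(t : ℂ) ^ 2) * F' (2 * a * t + p) *
      G' (2 * b * t + q)) * h
  have hint := (((hF.subGaussian'.integrable_mul hFc' hG.subGaussian hGc (2 * a) p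
    (2 * b) q).const_mul da).add ((hF.subGaussian.integrable_mul hFc hG.subGaussian' hGc'
    (2 * a) p (2 * b) q).const_mul db)).add ((hF.subGaussian.integrable_mul hFc hG.subGaussian
    hGc (2 * a) p (2 * b) q).const_mul (2 * κ)) |>.neg
  -- Only the integrability half is used: an affine parameter curve, with weight `1` at `s = 0`, has
  -- the required integrand as its derivative there.
  have hder := (hF.hasDerivAt_integral hG (a := fun s => 2 * (a + s * da))
    (a' := fun _ => 2 * da) (p := fun s => p + s * (-4 * a * κ)) (p' := fun _ => -4 * a * κ)
    (b := fun s => 2 * (b + s * db)) (b' := fun _ => 2 * db)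
    (q := fun s => q + s * (-4 * b * κ)) (q' := fun _ => -4 * b * κ)
    (e := fun s => 1 + s * (-2 * (a * da * p + b * db * q)))
    (e' := fun _ => -2 * (a * da * p + b * db * q)) ?_ ?_ ?_ ?_ ?_ continuous_const
    continuous_const continuous_const continuous_const continuous_const 0).1
  · refine MeasureTheory.integral_eq_zero_of_hasDerivAt_of_integrable hd ?_ ?_
    · refine hder.congr (.of_forall fun t => ?_)
      simp only [Complex.ofReal_zero, zero_mul, add_zero]
      ring_nf
    · refine hint.congr (.of_forall fun t => ?_)
      simp only [Pi.neg_apply, Pi.add_apply]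
      ring
  all_goals
    intro s
    have h0 : HasDerivAt (fun s : ℝ => (s : ℂ)) 1 s := Complex.ofRealCLM.hasDerivAt
  · simpa using ((h0.mul_const da).const_add a).const_mul 2
  · simpa using (h0.mul_const (-4 * a * κ)).const_add p
  · simpa using ((h0.mul_const db).const_add b).const_mul 2
  · simpa using (h0.mul_const (-4 * b * κ)).const_add q
  · simpa using (h0.mul_const (-2 * (a * da * p + b * db * q))).const_add 1

/-- The Gaussian integral of `F (2 a t + p) * G (2 b t + q)`, for the quartic shifts `p`, `q`
and the exponential weight that make it a function of `a * b`. -/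
noncomputable def _root_.weightedGaussIntegral (F G : ℂ → ℂ) (k a b : ℂ) : ℂ :=
  ∫ t : ℝ, Complex.exp (-(t : ℂ) ^ 2) *
    (Complex.exp ((a ^ 6 + b ^ 6) / 3 - k * a ^ 2 * b ^ 2 * (a ^ 2 + b ^ 2)) *
      (F (2 * a * t + (-a ^ 4 + k * a ^ 2 * b ^ 2 - 2 * a * b ^ 3)) *
        G (2 * b * t + (-b ^ 4 + k * a ^ 2 * b ^ 2 - 2 * a ^ 3 * b))))

/-- The weighted Gaussian integral only depends on the product `a * b`
along a smooth curve of parameters. -/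
lemma integral_const_along (hF : IsAirySolution F F') (hG : IsAirySolution G G') (k : ℂ)
    {a b a' b' : ℝ → ℂ} (ha : ∀ s, HasDerivAt a (a' s) s) (hb : ∀ s, HasDerivAt b (b' s) s)
    (ha' : Continuous a') (hb' : Continuous b') (h : ∀ s, a' s * b s + a s * b' s = 0)
    (x y : ℝ) :
    weightedGaussIntegral F G k (a x) (b x) = weightedGaussIntegral F G k (a y) (b y) := by
  have hac : Continuous a := continuous_iff_continuousAt.2 fun z => (ha z).continuousAt
  have hbc : Continuous b := continuous_iff_continuousAt.2 fun z => (hb z).continuousAt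
  set p : ℝ → ℂ := fun s => -a s ^ 4 + k * a s ^ 2 * b s ^ 2 - 2 * a s * b s ^ 3 with hp
  set q : ℝ → ℂ := fun s => -b s ^ 4 + k * a s ^ 2 * b s ^ 2 - 2 * a s ^ 3 * b s with hq
  set e : ℝ → ℂ := fun s => Complex.exp ((a s ^ 6 + b s ^ 6) / 3 -
    k * a s ^ 2 * b s ^ 2 * (a s ^ 2 + b s ^ 2)) with he
  -- This is where the quartics come from: the exact primitive forces this velocity, and with `m =
  -- ab` constant it integrates to `-a⁴ - 2m b²` plus a constant, taken to be `k m²`. The weight `e`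
  -- arises likewise from its logarithmic derivative.
  have hp' : ∀ s, HasDerivAt p (-4 * a s * (a s ^ 2 * a' s + b s ^ 2 * b' s)) s := by
    intro s
    have := ((((ha s).pow 4).neg.add ((((ha s).pow 2).const_mul k).mul ((hb s).pow 2))).sub
      (((ha s).const_mul 2).mul ((hb s).pow 3)))
    refine this.congr_deriv ?_
    simp only [Pi.pow_apply]
    push_cast
    linear_combination (2 * k * a s * b s - 2 * b s ^ 2) * h s
  have hq' : ∀ s, HasDerivAt q (-4 * b s * (a s ^ 2 * a' s + b s ^ 2 * b' s)) s := by
    intro s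
    have := ((((hb s).pow 4).neg.add ((((ha s).pow 2).const_mul k).mul ((hb s).pow 2))).sub
      ((((ha s).pow 3).const_mul 2).mul (hb s)))
    refine this.congr_deriv ?_
    simp only [Pi.pow_apply]
    push_cast
    linear_combination (2 * k * a s * b s - 2 * a s ^ 2) * h s
  have he' : ∀ s, HasDerivAt e (e s * (-2 * (a s * a' s * p s + b s * b' s * q s))) s := by
    intro s
    have := ((((ha s).pow 6).add ((hb s).pow 6)).div_const 3).sub
      (((((ha s).pow 2).const_mul k).mul ((hb s).pow 2)).mul
        (((ha s).pow 2).add ((hb s).pow 2))) |>.cexp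
    refine this.congr_deriv ?_
    simp only [Pi.pow_apply, Pi.sub_apply, Pi.mul_apply, Pi.add_apply, he, hp, hq]
    push_cast
    linear_combination (Complex.exp ((a s ^ 6 + b s ^ 6) / 3 -
      k * a s ^ 2 * b s ^ 2 * (a s ^ 2 + b s ^ 2))) * (-2 * k * a s * b s *
        (a s ^ 2 + b s ^ 2) - 4 * a s ^ 2 * b s ^ 2) * h s
  have hpc : Continuous p := continuous_iff_continuousAt.2 fun z => (hp' z).continuousAt
  have hqc : Continuous q := continuous_iff_continuousAt.2 fun z => (hq' z).continuousAt
  have hec : Continuous e := continuous_iff_continuousAt.2 fun z => (he' z).continuousAt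
  have hder : ∀ s, HasDerivAt (fun s => weightedGaussIntegral F G k (a s) (b s)) 0 s := by
    intro s
    have h1 := (hF.hasDerivAt_integral hG (fun s => (ha s).const_mul 2) hp'
      (fun s => (hb s).const_mul 2) hq' he' (by fun_prop) (by fun_prop) (by fun_prop)
      (by fun_prop) (by fun_prop) s).2
    refine h1.congr_deriv ?_
    have h2 := hF.integral_directional_eq_zero hG (a s) (b s) (a' s) (b' s) (p s) (q s) (h s)
    rw [← mul_zero (e s), ← h2, ← MeasureTheory.integral_const_mul]
    congr 1
    ext t
    ring
  exact is_const_of_deriv_eq_zero (fun s => (hder s).differentiableAt)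
    (fun s => (hder s).deriv) x y

/-- Level sets of `ab` are connected by explicit curves: if `ab = 0`, both points are joined to the
origin by segments on which the product stays zero; otherwise `(a e^{sσ}, b e^{-sσ})` with `e^σ = c
/ a` does it. -/
lemma weightedGaussIntegral_congr (hF : IsAirySolution F F') (hG : IsAirySolution G G')
    {k a b c d : ℂ} (h : a * b = c * d) :
    weightedGaussIntegral F G k a b = weightedGaussIntegral F G k c d := by
  have h0 : ∀ s : ℝ, HasDerivAt (fun s : ℝ => (s : ℂ)) 1 s := fun s =>
    Complex.ofRealCLM.hasDerivAt
  by_cases hab : a * b = 0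
  · have key : ∀ a b : ℂ, a * b = 0 →
        weightedGaussIntegral F G k a b = weightedGaussIntegral F G k 0 0 := by
      intro a b hab
      have := hF.integral_const_along hG k (a := fun s => s * a) (b := fun s => s * b)
        (a' := fun _ => a) (b' := fun _ => b) (fun s => by simpa using (h0 s).mul_const a)
        (fun s => by simpa using (h0 s).mul_const b) continuous_const continuous_const
        (fun s => by linear_combination (2 * (s : ℂ)) * hab) 1 0
      simpa using this
    rw [key a b hab, key c d (h ▸ hab)]
  · obtain ⟨ha, hb⟩ := mul_ne_zero_iff.1 hab
    obtain ⟨hc, hd⟩ := mul_ne_zero_iff.1 (h ▸ hab)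
    set σ := Complex.log (c / a) with hσ
    have hexp : Complex.exp σ = c / a := Complex.exp_log (div_ne_zero hc ha)
    have hA : ∀ s : ℝ, HasDerivAt (fun s : ℝ => a * Complex.exp (s * σ))
        (a * (Complex.exp (s * σ) * σ)) s := fun s => by
      simpa using (((h0 s).mul_const σ).cexp).const_mul a
    have hB : ∀ s : ℝ, HasDerivAt (fun s : ℝ => b * Complex.exp (-(s * σ)))
        (b * (Complex.exp (-(s * σ)) * -σ)) s := fun s => by
      simpa using (((h0 s).mul_const σ).neg.cexp).const_mul b
    have := hF.integral_const_along hG k hA hB (by fun_prop) (by fun_prop)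
      (fun s => by ring) 0 1
    have hd' : b * (a / c) = d := by
      field_simp
      linear_combination h
    simpa [Complex.exp_neg, hexp, mul_div_cancel₀ _ ha, hd'] using this

end IsAirySolution

/-! ### Airy power series and the growth of the two atoms. -/

lemma hasDerivAt_of_hasSum_pow {c : ℕ → ℂ} {F : ℂ → ℂ}
    (h : ∀ z, HasSum (fun n => c n * z ^ n) (F z)) :
    ∃ F' : ℂ → ℂ, (∀ z, HasDerivAt F (F' z) z) ∧
      ∀ z, HasSum (fun n : ℕ => (n + 1) * c (n + 1) * z ^ n) (F' z) := by
  have hF : F = fun z => ∑' n, c n * z ^ n := funext fun z => (h z).tsum_eq.symm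
  -- By `n ≤ 2ⁿ`, the differentiated series on radius `r` is dominated by the original one at `2(r +
  -- 1)`, which converges since `F` is entire.
  have hbound : ∀ (r : ℝ) (n : ℕ) (z : ℂ), ‖z‖ ≤ r →
      ‖c n * (n * z ^ (n - 1))‖ ≤ ‖c n * ((2 * (r + 1) : ℝ) : ℂ) ^ n‖ := by
    intro r n z hz
    have hr : 0 ≤ r := (norm_nonneg z).trans hz
    rw [norm_mul, norm_mul, norm_mul, norm_pow, norm_pow, Complex.norm_real, Complex.norm_natCast,
      Real.norm_of_nonneg (by positivity), mul_pow]
    have h1 : (n : ℝ) ≤ 2 ^ n := by exact_mod_cast Nat.lt_two_pow_self.le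
    have h2 : ‖z‖ ^ (n - 1) ≤ (r + 1) ^ n := by
      calc ‖z‖ ^ (n - 1) ≤ (r + 1) ^ (n - 1) := by gcongr; linarith
        _ ≤ (r + 1) ^ n := pow_le_pow_right₀ (by linarith) (Nat.sub_le n 1)
    gcongr
  have hsum : ∀ z, Summable fun n : ℕ => c n * (n * z ^ (n - 1)) := fun z =>
    Summable.of_norm_bounded (h _).summable.norm fun n => hbound ‖z‖ n z le_rfl
  refine ⟨fun z => ∑' n : ℕ, c n * (n * z ^ (n - 1)), fun z => ?_, fun z => ?_⟩
  · rw [hF]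
    refine hasDerivAt_tsum_of_isPreconnected (t := Metric.ball 0 (‖z‖ + 1)) (y₀ := 0)
      (h ((2 * (‖z‖ + 1 + 1) : ℝ) : ℂ)).summable.norm Metric.isOpen_ball
      (convex_ball _ _).isPreconnected (fun n y _ => (hasDerivAt_pow n y).const_mul _)
      (fun n y hy => hbound (‖z‖ + 1) n y ?_) (by simp; positivity) (h 0).summable (by simp)
    simpa using (Metric.mem_ball.1 hy).le
  · have := (hasSum_nat_add_iff' 1).2 (hsum z).hasSum
    simp only [Finset.range_one, Finset.sum_singleton, Nat.cast_zero, zero_mul, mul_zero,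
      sub_zero, Nat.add_sub_cancel] at this
    refine this.congr_fun fun n => ?_
    push_cast
    ring

/-- `F` is an entire solution of the Airy equation with nonnegative Taylor coefficients `c`
and sub-Gaussian growth. -/
structure IsAirySeries (c : ℕ → ℝ) (F : ℂ → ℂ) : Prop where
  nonneg : ∀ n, 0 ≤ c n
  two : c 2 = 0
  succ : ∀ n : ℕ, ((n : ℝ) + 3) * (n + 2) * c (n + 3) = c n
  hasSum : ∀ z, HasSum (fun n => (c n : ℂ) * z ^ n) (F z)
  subGaussian : SubGaussian F

lemma IsAirySeries.exists_isAirySolution {c : ℕ → ℝ} {F : ℂ → ℂ} (h : IsAirySeries c F) :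
    ∃ F', IsAirySolution F F' := by
  obtain ⟨F', hF', hs'⟩ := hasDerivAt_of_hasSum_pow h.hasSum
  obtain ⟨F'', hF'', hs''⟩ := hasDerivAt_of_hasSum_pow hs'
  have hderiv : F' = deriv F := funext fun z => (hF' z).deriv.symm
  refine ⟨F', hF', fun z => ?_, h.subGaussian, ?_⟩
  · convert hF'' z using 1
    have h1 := (hasSum_nat_add_iff' 1).2 (hs'' z)
    simp only [Finset.range_one, Finset.sum_singleton, zero_add, h.two] at h1
    norm_num [h.two] at h1
    refine ((h.hasSum z).mul_left z).unique (h1.congr_fun fun n => ?_)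
    rw [← h.succ n]
    push_cast
    ring_nf
  · rw [hderiv]
    exact h.subGaussian.deriv fun z => (hF' z).differentiableAt

/-- Taylor coefficients of the solution of `w'' = z w` with `w(0) = x`, `w'(0) = y`. -/
noncomputable def airyCoeff (x y : ℝ) : ℕ → ℝ
  | 0 => x
  | 1 => y
  | 2 => 0
  | n + 3 => airyCoeff x y n / ((n + 3) * (n + 2))

lemma airyCoeff_nonneg {x y : ℝ} (hx : 0 ≤ x) (hy : 0 ≤ y) : ∀ n, 0 ≤ airyCoeff x y n
  | 0 => hx
  | 1 => hy
  | 2 => le_rfl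
  | n + 3 => div_nonneg (airyCoeff_nonneg hx hy n) (by positivity)

lemma airyCoeff_succ (x y : ℝ) (n : ℕ) :
    ((n : ℝ) + 3) * (n + 2) * airyCoeff x y (n + 3) = airyCoeff x y n := by
  rw [airyCoeff]
  field_simp

lemma airyCoeff_three_mul (y : ℝ) (k : ℕ) :
    (airyCoeff 1 y (3 * k) : ℂ) =
      (ascPochhammer ℂ k).eval (1 / 3) * 3 ^ k / ((3 * k)! : ℂ) := by
  induction k with
  | zero => simp [airyCoeff]
  | succ k ih =>
    have h0 : ((3 * k)! : ℂ) ≠ 0 := by exact_mod_cast (3 * k).factorial_ne_zero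
    have h1 : 3 * (k : ℂ) + 1 ≠ 0 := by norm_cast
    have h2 : 3 * (k : ℂ) + 2 ≠ 0 := by norm_cast
    have h3 : (k : ℂ) + 1 ≠ 0 := by norm_cast
    have hfac : ((3 * k + 3)! : ℂ) = 3 * (k + 1) * (3 * k + 2) * (3 * k + 1) * (3 * k)! := by
      simp only [Nat.factorial_succ]
      push_cast
      ring
    rw [show 3 * (k + 1) = 3 * k + 3 by ring, airyCoeff, ascPochhammer_succ_eval, hfac]
    push_cast
    rw [ih, show 3 * (k : ℂ) + 3 = 3 * (k + 1) by ring]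
    field_simp
    ring

lemma airyCoeff_three_mul_add_one (x : ℝ) (k : ℕ) :
    (airyCoeff x 1 (3 * k + 1) : ℂ) =
      (ascPochhammer ℂ k).eval (2 / 3) * 3 ^ k / ((3 * k + 1)! : ℂ) := by
  induction k with
  | zero => simp [airyCoeff]
  | succ k ih =>
    have h0 : ((3 * k + 1)! : ℂ) ≠ 0 := by exact_mod_cast (3 * k + 1).factorial_ne_zero
    have h1 : 3 * (k : ℂ) + 2 ≠ 0 := by norm_cast
    have h2 : (k : ℂ) + 1 ≠ 0 := by norm_cast
    have h3 : 3 * (k : ℂ) + 4 ≠ 0 := by norm_cast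
    have hfac : ((3 * k + 1 + 3)! : ℂ) =
        (3 * k + 4) * (3 * (k + 1)) * (3 * k + 2) * (3 * k + 1)! := by
      simp only [Nat.factorial_succ]
      push_cast
      ring
    rw [show 3 * (k + 1) + 1 = 3 * k + 1 + 3 by ring, airyCoeff, ascPochhammer_succ_eval, hfac]
    push_cast
    rw [ih, show 3 * (k : ℂ) + 1 + 3 = 3 * k + 4 by ring,
      show 3 * (k : ℂ) + 1 + 2 = 3 * (k + 1) by ring]
    field_simp
    ring

lemma airyCoeff_add_three_mul_eq_zero {x y : ℝ} {j : ℕ} (h : airyCoeff x y j = 0) (k : ℕ) :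
    airyCoeff x y (j + 3 * k) = 0 := by
  induction k with
  | zero => exact h
  | succ k ih => rw [show j + 3 * (k + 1) = j + 3 * k + 3 by ring, airyCoeff, ih, zero_div]

lemma norm_ascPochhammer_eval_le {x : ℂ} (hx : ‖x‖ ≤ 1) (k : ℕ) :
    ‖(ascPochhammer ℂ k).eval x‖ ≤ k ! := by
  induction k with
  | zero => simp
  | succ k ih =>
    rw [ascPochhammer_succ_eval, norm_mul, Nat.factorial_succ, mul_comm]
    push_cast
    gcongr
    refine (norm_add_le _ _).trans ?_
    rw [Complex.norm_natCast]
    linarith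

/-- From `|(x)ₖ| ≤ k!` and `k! (2k)! ≤ (3k)!`. The majorant is a term of the series of `cosh
√(3‖z‖³)`, which exhibits order 3/2. -/
lemma norm_airyAtom_term_le {x : ℂ} (hx : ‖x‖ ≤ 1) (z : ℂ) (k : ℕ) :
    ‖(ascPochhammer ℂ k).eval x * 3 ^ k * z ^ (3 * k) / ((3 * k)! : ℂ)‖ ≤
      √(3 * ‖z‖ ^ 3) ^ (2 * k) / ((2 * k)! : ℝ) := by
  rw [norm_div, norm_mul, norm_mul, norm_pow, norm_pow, Complex.norm_natCast, pow_mul √_,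
    Real.sq_sqrt (by positivity), mul_pow, ← pow_mul, Complex.norm_ofNat]
  have h1 : (k ! : ℝ) * (2 * k)! ≤ (3 * k)! := by
    have := Nat.le_of_dvd (Nat.factorial_pos _)
      (Nat.factorial_mul_factorial_dvd_factorial_add k (2 * k))
    rw [show k + 2 * k = 3 * k by ring] at this
    exact_mod_cast this
  have h2 : (0 : ℝ) < (2 * k)! := by positivity
  have h3 : (0 : ℝ) < (3 * k)! := by positivity
  rw [div_le_div_iff₀ h3 h2]
  calc _ ≤ (k ! : ℝ) * 3 ^ k * ‖z‖ ^ (3 * k) * (2 * k)! := by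
        gcongr
        exact norm_ascPochhammer_eval_le hx k
    _ = 3 ^ k * ‖z‖ ^ (3 * k) * (k ! * (2 * k)!) := by ring
    _ ≤ _ := by gcongr

lemma norm_airyAtomG_term_le (z : ℂ) (k : ℕ) :
    ‖(ascPochhammer ℂ k).eval (2 / 3) * 3 ^ k * z ^ (3 * k + 1) / ((3 * k + 1)! : ℂ)‖ ≤
      ‖z‖ * (√(3 * ‖z‖ ^ 3) ^ (2 * k) / ((2 * k)! : ℝ)) := by
  have h := norm_airyAtom_term_le (x := 2 / 3) (by norm_num) z k
  have h1 : (1 : ℝ) ≤ ‖(3 * k + 1 : ℂ)‖ := by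
    have : (3 * k + 1 : ℂ) = ((3 * k + 1 : ℕ) : ℂ) := by push_cast; ring
    rw [this, Complex.norm_natCast]
    exact_mod_cast Nat.succ_pos _
  calc _ = ‖z‖ * ‖(ascPochhammer ℂ k).eval (2 / 3) * 3 ^ k * z ^ (3 * k) / ((3 * k)! : ℂ)‖ /
          ‖(3 * k + 1 : ℂ)‖ := by
        rw [← norm_mul, ← norm_div, Nat.factorial_succ, pow_succ]
        congr 1
        push_cast
        field_simp
    _ ≤ ‖z‖ * ‖(ascPochhammer ℂ k).eval (2 / 3) * 3 ^ k * z ^ (3 * k) / ((3 * k)! : ℂ)‖ :=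
        div_le_self (by positivity) h1
    _ ≤ _ := by gcongr

lemma hasSum_airyAtomF (z : ℂ) :
    HasSum (fun n => (airyCoeff 1 0 n : ℂ) * z ^ n) (airyAtomF z) := by
  have hinj : Function.Injective fun k : ℕ => 3 * k := fun m n h => by simpa using h
  refine (hinj.hasSum_iff ?_).1 (((Summable.of_norm_bounded
    (Real.hasSum_cosh √(3 * ‖z‖ ^ 3)).summable
    (norm_airyAtom_term_le (x := 1 / 3) (by norm_num) z)).hasSum).congr_fun fun k => ?_)
  · intro n hn
    have hn' : n % 3 = 1 ∨ n % 3 = 2 := by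
      have : n % 3 ≠ 0 := fun h => hn ⟨n / 3, by simp only; omega⟩
      omega
    have : airyCoeff 1 0 n = 0 := by
      rw [← Nat.mod_add_div n 3]
      rcases hn' with h | h <;> rw [h] <;>
        exact airyCoeff_add_three_mul_eq_zero (by simp [airyCoeff]) _
    simp [this]
  · simp only [Function.comp, airyCoeff_three_mul]
    ring

lemma hasSum_airyAtomG (z : ℂ) :
    HasSum (fun n => (airyCoeff 0 1 n : ℂ) * z ^ n) (airyAtomG z) := by
  have hinj : Function.Injective fun k : ℕ => 3 * k + 1 := fun m n h => by simpa using h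
  refine (hinj.hasSum_iff ?_).1 (((Summable.of_norm_bounded
    ((Real.hasSum_cosh √(3 * ‖z‖ ^ 3)).summable.mul_left ‖z‖)
    (norm_airyAtomG_term_le z)).hasSum).congr_fun fun k => ?_)
  · intro n hn
    have hn' : n % 3 = 0 ∨ n % 3 = 2 := by
      have : n % 3 ≠ 1 := fun h => hn ⟨n / 3, by simp only; omega⟩
      omega
    have : airyCoeff 0 1 n = 0 := by
      rw [← Nat.mod_add_div n 3]
      rcases hn' with h | h <;> rw [h] <;>
        exact airyCoeff_add_three_mul_eq_zero (by simp [airyCoeff]) _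
    simp [this]
  · simp only [Function.comp, airyCoeff_three_mul_add_one]
    ring

lemma subGaussian_of_norm_le {F : ℂ → ℂ}
    (h : ∀ z, ‖F z‖ ≤ (1 + ‖z‖) * Real.cosh √(3 * ‖z‖ ^ 3)) : SubGaussian F := by
  intro δ hδ
  -- AM-GM bounds `√(3r³)` by `(δ/2) r² + 3r/(2δ)`, while `1 + r ≤ eʳ`; `K` is the total coefficient
  -- of `r`, absorbed by a second AM-GM.
  set K : ℝ := 1 + 3 / (2 * δ) with hK
  refine ⟨Real.exp (K ^ 2 / (2 * δ)), fun z => (h z).trans ?_⟩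
  have hz := norm_nonneg z
  have h1 : Real.cosh √(3 * ‖z‖ ^ 3) ≤ Real.exp √(3 * ‖z‖ ^ 3) := by
    rw [Real.cosh_eq]
    have : Real.exp (-√(3 * ‖z‖ ^ 3)) ≤ Real.exp √(3 * ‖z‖ ^ 3) :=
      Real.exp_le_exp.2 (by linarith [Real.sqrt_nonneg (3 * ‖z‖ ^ 3)])
    linarith
  have h2 : √(3 * ‖z‖ ^ 3) ≤ δ / 2 * ‖z‖ ^ 2 + 3 / (2 * δ) * ‖z‖ := by
    refine Real.sqrt_le_iff.2 ⟨by positivity, ?_⟩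
    have h3 : 4 * (δ / 2 * ‖z‖ ^ 2) * (3 / (2 * δ) * ‖z‖) = 3 * ‖z‖ ^ 3 := by
      field_simp
      ring
    linarith [four_mul_le_sq_add (δ / 2 * ‖z‖ ^ 2) (3 / (2 * δ) * ‖z‖)]
  have h4 : K * ‖z‖ ≤ δ / 2 * ‖z‖ ^ 2 + K ^ 2 / (2 * δ) := by
    have h5 : 4 * (δ / 2 * ‖z‖ ^ 2) * (K ^ 2 / (2 * δ)) = (K * ‖z‖) ^ 2 := by
      field_simp
      ring
    refine abs_le_of_sq_le_sq' ?_ (by positivity) |>.2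
    linarith [four_mul_le_sq_add (δ / 2 * ‖z‖ ^ 2) (K ^ 2 / (2 * δ))]
  calc (1 + ‖z‖) * Real.cosh √(3 * ‖z‖ ^ 3) ≤ Real.exp ‖z‖ * Real.exp √(3 * ‖z‖ ^ 3) := by
        gcongr
        linarith [Real.add_one_le_exp ‖z‖]
    _ ≤ Real.exp (K ^ 2 / (2 * δ)) * Real.exp (δ * ‖z‖ ^ 2) := by
        rw [← Real.exp_add, ← Real.exp_add]
        refine Real.exp_le_exp.2 ?_
        rw [hK] at h4 ⊢
        linarith

lemma isAirySeries_airyAtomF : IsAirySeries (airyCoeff 1 0) airyAtomF where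
  nonneg := airyCoeff_nonneg zero_le_one le_rfl
  two := by simp [airyCoeff]
  succ := airyCoeff_succ 1 0
  hasSum := hasSum_airyAtomF
  subGaussian := subGaussian_of_norm_le fun z => by
    have h := Real.hasSum_cosh √(3 * ‖z‖ ^ 3)
    refine (tsum_of_norm_bounded h
      (norm_airyAtom_term_le (x := 1 / 3) (by norm_num) z)).trans ?_
    nlinarith [norm_nonneg z, Real.cosh_pos √(3 * ‖z‖ ^ 3),
      mul_nonneg (norm_nonneg z) (Real.cosh_pos √(3 * ‖z‖ ^ 3)).le]

lemma isAirySeries_airyAtomG : IsAirySeries (airyCoeff 0 1) airyAtomG where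
  nonneg := airyCoeff_nonneg le_rfl zero_le_one
  two := by simp [airyCoeff]
  succ := airyCoeff_succ 0 1
  hasSum := hasSum_airyAtomG
  subGaussian := subGaussian_of_norm_le fun z => by
    have h := (Real.hasSum_cosh √(3 * ‖z‖ ^ 3)).mul_left ‖z‖
    refine (tsum_of_norm_bounded h (norm_airyAtomG_term_le z)).trans ?_
    nlinarith [norm_nonneg z, Real.cosh_pos √(3 * ‖z‖ ^ 3),
      mul_nonneg (norm_nonneg z) (Real.cosh_pos √(3 * ‖z‖ ^ 3)).le]

/-! ### Gaussian moments. -/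

/-- The moments of the weight `exp (-t²)`. -/
noncomputable def gaussMoment (n : ℕ) : ℂ := ∫ t : ℝ, Complex.exp (-(t : ℂ) ^ 2) * (t : ℂ) ^ n

lemma integrable_cexp_neg_sq_mul_pow (n : ℕ) :
    MeasureTheory.Integrable fun t : ℝ => Complex.exp (-(t : ℂ) ^ 2) * (t : ℂ) ^ n := by
  refine integrable_cexp_neg_sq_mul (by fun_prop) (C := (2 * n + 1) ^ n) fun t => ?_
  rw [norm_pow, Complex.norm_real, Real.norm_eq_abs]
  have hm : (0 : ℝ) < 2 * n + 1 := by positivity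
  -- The denominator keeps the exponent of the `n`-th power below `t²/2`, since `n ≤ 2n + 1`.
  have h1 : |t| ≤ (2 * n + 1) * Real.exp (t ^ 2 / (2 * (2 * n + 1))) := by
    have h2 := Real.add_one_le_exp (t ^ 2 / (2 * (2 * n + 1)))
    calc |t| ≤ t ^ 2 / 2 + (2 * n + 1) := by
          nlinarith [sq_nonneg (|t| - 1), sq_abs t, (Nat.cast_nonneg n : (0 : ℝ) ≤ n)]
      _ = (2 * n + 1) * (t ^ 2 / (2 * (2 * n + 1)) + 1) := by field_simp
      _ ≤ _ := by gcongr
  calc |t| ^ n ≤ ((2 * n + 1) * Real.exp (t ^ 2 / (2 * (2 * n + 1)))) ^ n := by gcongr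
    _ = (2 * n + 1) ^ n * Real.exp (n * (t ^ 2 / (2 * (2 * n + 1)))) := by
      rw [mul_pow, ← Real.exp_nat_mul]
    _ ≤ (2 * n + 1) ^ n * Real.exp (t ^ 2 / 2) := by
      gcongr
      rw [← mul_div_assoc, div_le_div_iff₀ (by positivity) two_pos]
      nlinarith [sq_nonneg t, mul_nonneg (Nat.cast_nonneg n : (0 : ℝ) ≤ n) (sq_nonneg t)]

lemma gaussMoment_zero : gaussMoment 0 = √Real.pi := by
  have h := integral_gaussian 1
  rw [div_one] at h
  rw [← h, gaussMoment, ← integral_complex_ofReal]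
  congr 1
  ext t
  push_cast
  simp

lemma hasDerivAt_cexp_neg_sq (t : ℝ) : HasDerivAt (fun t : ℝ => Complex.exp (-(t : ℂ) ^ 2))
    (Complex.exp (-(t : ℂ) ^ 2) * (-(2 * t))) t := by
  have he : HasDerivAt (fun t : ℂ => Complex.exp (-t ^ 2))
      (Complex.exp (-(t : ℂ) ^ 2) * (-(2 * t))) (t : ℂ) := by
    simpa using ((hasDerivAt_id (t : ℂ)).pow 2).neg.cexp
  exact he.comp_ofReal

lemma gaussMoment_one : gaussMoment 1 = 0 := by
  have h := MeasureTheory.integral_eq_zero_of_hasDerivAt_of_integrable hasDerivAt_cexp_neg_sq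
    (((integrable_cexp_neg_sq_mul_pow 1).const_mul (-2)).congr (.of_forall fun t => by
      simp only; ring)) (by simpa using integrable_cexp_neg_sq_mul_pow 0)
  have h2 : -2 * gaussMoment 1 = 0 := by
    rw [← h, gaussMoment, ← MeasureTheory.integral_const_mul]
    congr 1
    ext t
    ring
  simpa using h2

/-- Integration by parts: the derivative of `e^{-t²} tⁿ⁺¹` integrates to zero. -/
lemma two_mul_gaussMoment_add_two (n : ℕ) :
    2 * gaussMoment (n + 2) = (n + 1) * gaussMoment n := by
  have hd : ∀ t : ℝ, HasDerivAt (fun t : ℝ => Complex.exp (-(t : ℂ) ^ 2) * (t : ℂ) ^ (n + 1))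
      ((n + 1) * (Complex.exp (-(t : ℂ) ^ 2) * (t : ℂ) ^ n) -
        2 * (Complex.exp (-(t : ℂ) ^ 2) * (t : ℂ) ^ (n + 2))) t := by
    intro t
    have hp : HasDerivAt (fun t : ℝ => (t : ℂ) ^ (n + 1)) ((n + 1 : ℕ) * (t : ℂ) ^ n) t := by
      simpa using (hasDerivAt_pow (n + 1) (t : ℂ)).comp_ofReal
    refine ((hasDerivAt_cexp_neg_sq t).mul hp).congr_deriv ?_
    push_cast
    ring
  have h1 := (integrable_cexp_neg_sq_mul_pow n).const_mul ((n : ℂ) + 1)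
  have h2 := (integrable_cexp_neg_sq_mul_pow (n + 2)).const_mul 2
  have h := MeasureTheory.integral_eq_zero_of_hasDerivAt_of_integrable hd (h1.sub h2)
    (integrable_cexp_neg_sq_mul_pow (n + 1))
  rw [MeasureTheory.integral_sub h1 h2, MeasureTheory.integral_const_mul,
    MeasureTheory.integral_const_mul] at h
  rw [gaussMoment, gaussMoment]
  linear_combination -h

lemma gaussMoment_odd {n : ℕ} (hn : n % 2 = 1) : gaussMoment n = 0 := by
  obtain ⟨k, rfl⟩ : ∃ k, n = 2 * k + 1 := ⟨n / 2, by omega⟩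
  clear hn
  induction k with
  | zero => exact gaussMoment_one
  | succ k ih =>
    have h := two_mul_gaussMoment_add_two (2 * k + 1)
    rw [ih, mul_zero] at h
    simpa [mul_add] using h

lemma eight_mul_gaussMoment_add_six (n : ℕ) :
    8 * gaussMoment (n + 6) = (n + 5) * (n + 3) * (n + 1) * gaussMoment n := by
  have h1 := two_mul_gaussMoment_add_two n
  have h2 := two_mul_gaussMoment_add_two (n + 2)
  have h3 := two_mul_gaussMoment_add_two (n + 4)
  push_cast at h2 h3
  linear_combination 4 * h3 + 2 * (n + 5) * h2 + (n + 5) * (n + 3) * h1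

/-! ### Taylor coefficients of `F(z) F(εz)` and termwise integration. -/

section PowerSeries

open PowerSeries

lemma PowerSeries.coeff_X_mul_derivative (p : ℂ⟦X⟧) (n : ℕ) :
    coeff n (X * derivative ℂ p) = n * coeff n p := by
  cases n with
  | zero => simp
  | succ n =>
    rw [coeff_succ_X_mul, coeff_derivative]
    push_cast
    ring

/-- The formal power series of `F (ε z)` for `F` with Taylor coefficients `c`. -/
noncomputable def scaledSeries (c : ℕ → ℝ) (ε : ℂ) : ℂ⟦X⟧ := mk fun n => ε ^ n * c n

variable {c : ℕ → ℝ} {F : ℂ → ℂ}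

lemma IsAirySeries.derivative_derivative (h : IsAirySeries c F) (ε : ℂ) :
    derivative ℂ (derivative ℂ (scaledSeries c ε)) = C (ε ^ 3) * (X * scaledSeries c ε) := by
  ext n
  rw [coeff_derivative, coeff_derivative, coeff_C_mul, scaledSeries, coeff_mk]
  cases n with
  | zero => simp [h.two]
  | succ n =>
    rw [coeff_succ_X_mul, coeff_mk, ← h.succ n]
    push_cast
    ring

/-- The coefficients of the square of an Airy series. -/
lemma IsAirySeries.coeff_sq_add_three (h : IsAirySeries c F) (n : ℕ) :
    ((n : ℂ) + 3) * (n + 2) * (n + 1) *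
        coeff (n + 3) (scaledSeries c 1 * scaledSeries c 1) =
      (4 * n + 2) * coeff n (scaledSeries c 1 * scaledSeries c 1) := by
  set P := scaledSeries c 1
  have hP : derivative ℂ (derivative ℂ P) = X * P := by
    simpa using h.derivative_derivative 1
  -- The symmetric square of the Airy equation: `w''' = 4z w' + 2w` for `w = F²`.
  have hode : derivative ℂ (derivative ℂ (derivative ℂ (P * P))) =
      4 * (X * derivative ℂ (P * P)) + 2 * (P * P) := by
    simp only [Derivation.leibniz, smul_eq_mul, map_add, hP, derivative_X]
    ring
  have := congrArg (coeff n) hode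
  rw [coeff_derivative, coeff_derivative, coeff_derivative, map_add,
    show (4 : ℂ⟦X⟧) = C 4 from (map_ofNat C 4).symm, show (2 : ℂ⟦X⟧) = C 2 from (map_ofNat C 2).symm,
    coeff_C_mul, coeff_C_mul, coeff_X_mul_derivative] at this
  push_cast at this
  linear_combination this

/-- The coefficients of `F z * F (-z)` for an Airy series `F`. -/
lemma IsAirySeries.coeff_mul_neg_add_six (h : IsAirySeries c F) (n : ℕ) :
    ((n : ℂ) + 6) * (n + 5) * (n + 4) * (n + 2) *
        coeff (n + 6) (scaledSeries c 1 * scaledSeries c (-1)) =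
      -4 * coeff n (scaledSeries c 1 * scaledSeries c (-1)) := by
  set P := scaledSeries c 1
  set M := scaledSeries c (-1)
  have hP : derivative ℂ (derivative ℂ P) = X * P := by
    simpa using h.derivative_derivative 1
  have hM : derivative ℂ (derivative ℂ M) = -(X * M) := by
    rw [h.derivative_derivative (-1)]
    norm_num
    rfl
  -- Because `P'' = XP` and `M'' = -XM`, one has `(PM)'' = 2P'M'`, so `PM` and this Wronskian form a
  -- closed system: `(PM)''' = 2XQ`, `Q' = -2X PM`. The coefficient of `Q` is eliminated at the end.
  set Q := P * derivative ℂ M - M * derivative ℂ P with hQ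
  have h1 : derivative ℂ (derivative ℂ (derivative ℂ (P * M))) = C 2 * (X * Q) := by
    rw [show (C 2 : ℂ⟦X⟧) = 2 from map_ofNat C 2]
    simp only [Derivation.leibniz, smul_eq_mul, map_add, map_neg, hP, hM, derivative_X, hQ]
    ring
  have h2 : derivative ℂ Q = C (-2) * (X * (P * M)) := by
    rw [map_neg, show (C 2 : ℂ⟦X⟧) = 2 from map_ofNat C 2]
    simp only [Derivation.leibniz, smul_eq_mul, map_sub, hP, hM, hQ]
    ring
  have e1 := congrArg (coeff (n + 3)) h1
  have e2 := congrArg (coeff (n + 1)) h2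
  rw [coeff_derivative, coeff_derivative, coeff_derivative, coeff_C_mul, coeff_succ_X_mul] at e1
  rw [coeff_derivative, coeff_C_mul, coeff_succ_X_mul] at e2
  push_cast at e1 e2
  linear_combination (n + 2 : ℂ) * e1 + 2 * e2

lemma IsAirySeries.hasSum_scaled (h : IsAirySeries c F) (ε z : ℂ) :
    HasSum (fun n => coeff n (scaledSeries c ε) * z ^ n) (F (ε * z)) := by
  refine (h.hasSum (ε * z)).congr_fun fun n => ?_
  rw [scaledSeries, coeff_mk, mul_pow]
  ring

lemma IsAirySeries.hasSum_mul (h : IsAirySeries c F) (ε z : ℂ) :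
    HasSum (fun n => coeff n (scaledSeries c 1 * scaledSeries c ε) * z ^ n)
      (F z * F (ε * z)) := by
  have h1 := h.hasSum_scaled 1 z
  rw [one_mul] at h1
  have h2 := h.hasSum_scaled ε z
  have hs := (summable_norm_sum_mul_antidiagonal_of_summable_norm h1.summable.norm
    h2.summable.norm).of_norm.hasSum
  rw [← tsum_mul_tsum_eq_tsum_sum_antidiagonal_of_summable_norm h1.summable.norm
    h2.summable.norm, h1.tsum_eq, h2.tsum_eq] at hs
  refine hs.congr_fun fun n => ?_
  rw [coeff_mul, Finset.sum_mul]
  refine Finset.sum_congr rfl fun i hi => ?_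
  rw [← Finset.HasAntidiagonal.mem_antidiagonal.1 hi, pow_add]
  ring

lemma IsAirySeries.norm_coeff_le (h : IsAirySeries c F) {ε : ℂ} (hε : ‖ε‖ = 1) (n : ℕ) :
    ‖coeff n (scaledSeries c 1 * scaledSeries c ε)‖ ≤
      ‖coeff n (scaledSeries c 1 * scaledSeries c 1)‖ := by
  have hsq : coeff n (scaledSeries c 1 * scaledSeries c 1) =
      ((∑ i ∈ Finset.HasAntidiagonal.antidiagonal n, c i.1 * c i.2 : ℝ) : ℂ) := by
    simp [coeff_mul, scaledSeries]
  rw [hsq, Complex.norm_real, Real.norm_of_nonneg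
    (Finset.sum_nonneg fun i _ => mul_nonneg (h.nonneg _) (h.nonneg _)), coeff_mul]
  refine norm_sum_le_of_le _ fun i _ => ?_
  simp [scaledSeries, hε, abs_of_nonneg (h.nonneg _)]

/-- Nonnegative Taylor coefficients make `F²` at `‖w t‖` dominate the series of norms, and `e^{-t²}
F(‖w t‖)²` is integrable by sub-Gaussian growth. -/
lemma IsAirySeries.hasSum_integral (h : IsAirySeries c F) {ε : ℂ} (hε : ‖ε‖ = 1) (w : ℂ) :
    HasSum (fun n => coeff n (scaledSeries c 1 * scaledSeries c ε) * w ^ n * gaussMoment n)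
      (∫ t : ℝ, Complex.exp (-(t : ℂ) ^ 2) * (F (w * t) * F (ε * (w * t)))) := by
  obtain ⟨F', hF'⟩ := h.exists_isAirySolution
  have hFc := hF'.continuous
  have hmaj : ∀ t : ℝ, HasSum (fun n => Real.exp (-t ^ 2) *
      (‖coeff n (scaledSeries c 1 * scaledSeries c 1)‖ * ‖w * t‖ ^ n))
      (Complex.exp (-(t : ℂ) ^ 2) * (F ((‖w * t‖ : ℝ)) * F ((‖w * t‖ : ℝ)))).re := by
    intro t
    have h1 := h.hasSum_mul 1 ((‖w * t‖ : ℝ) : ℂ)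
    rw [one_mul] at h1
    refine (Complex.hasSum_re (h1.mul_left (Complex.exp (-(t : ℂ) ^ 2)))).congr_fun fun n => ?_
    have hsq : coeff n (scaledSeries c 1 * scaledSeries c 1) =
        ((∑ i ∈ Finset.HasAntidiagonal.antidiagonal n, c i.1 * c i.2 : ℝ) : ℂ) := by
      simp [coeff_mul, scaledSeries]
    rw [hsq, Complex.norm_real, Real.norm_of_nonneg
      (Finset.sum_nonneg fun i _ => mul_nonneg (h.nonneg _) (h.nonneg _))]
    norm_cast
  have hint : MeasureTheory.Integrable fun t : ℝ =>
      Complex.exp (-(t : ℂ) ^ 2) * (F ((‖w * t‖ : ℝ)) * F ((‖w * t‖ : ℝ))) := by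
    obtain ⟨C, hC0, hC⟩ := h.subGaussian.exists_norm_mul_le h.subGaussian ‖w‖
    refine integrable_cexp_neg_sq_mul (by fun_prop) (C := C) fun t => ?_
    have hb : ‖((‖w * t‖ : ℝ) : ℂ)‖ ≤ ‖w‖ * (1 + |t|) := by
      rw [Complex.norm_real, norm_norm, norm_mul, Complex.norm_real, Real.norm_eq_abs]
      gcongr
      linarith
    refine (hC t _ _ hb hb).trans ?_
    gcongr
    linarith
  have key := MeasureTheory.hasSum_integral_of_dominated_convergence
    (F := fun n (t : ℝ) => Complex.exp (-(t : ℂ) ^ 2) *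
      (coeff n (scaledSeries c 1 * scaledSeries c ε) * (w * t) ^ n))
    (f := fun t : ℝ => Complex.exp (-(t : ℂ) ^ 2) * (F (w * t) * F (ε * (w * t))))
    (μ := MeasureTheory.volume)
    (fun n (t : ℝ) => Real.exp (-t ^ 2) *
      (‖coeff n (scaledSeries c 1 * scaledSeries c 1)‖ * ‖w * t‖ ^ n))
    (fun n => Continuous.aestronglyMeasurable (by fun_prop))
    (fun n => .of_forall fun t => by
      rw [norm_mul, norm_cexp_neg_sq, norm_mul, norm_pow]
      gcongr
      exact h.norm_coeff_le hε n)
    (.of_forall fun t => (hmaj t).summable)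
    (hint.re.congr (.of_forall fun t => (hmaj t).tsum_eq.symm))
    (.of_forall fun t => (h.hasSum_mul ε (w * t)).mul_left _)
  refine key.congr_fun fun n => ?_
  rw [gaussMoment, ← MeasureTheory.integral_const_mul]
  congr 1
  ext t
  ring

end PowerSeries

/-! ### Recognising and evaluating the `₂F₂` series. -/

lemma eq_mul_hypergeom22_term {T : ℕ → ℂ} {a₁ a₂ b₁ b₂ z : ℂ} (hb₁ : ∀ m : ℕ, b₁ + m ≠ 0)
    (hb₂ : ∀ m : ℕ, b₂ + m ≠ 0)
    (hT : ∀ m : ℕ, (b₁ + m) * (b₂ + m) * (m + 1) * T (m + 1) =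
      (a₁ + m) * (a₂ + m) * z * T m) (m : ℕ) :
    T m = T 0 * ((ascPochhammer ℂ m).eval a₁ * (ascPochhammer ℂ m).eval a₂ /
      ((ascPochhammer ℂ m).eval b₁ * (ascPochhammer ℂ m).eval b₂) * (z ^ m / (m ! : ℂ))) := by
  induction m with
  | zero => simp
  | succ m ih =>
    have h1 : (m : ℂ) + 1 ≠ 0 := by norm_cast
    have h2 := hb₁ m
    have h3 := hb₂ m
    have h4 : T (m + 1) = (a₁ + m) * (a₂ + m) * z * T m / ((b₁ + m) * (b₂ + m) * (m + 1)) := by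
      rw [eq_div_iff (by positivity), ← hT m]
      ring
    rw [h4, ih, Nat.factorial_succ]
    simp only [ascPochhammer_succ_eval]
    push_cast
    simp only [div_eq_mul_inv, mul_inv]
    ring

/-- A series supported on one residue class mod `6` whose nonzero terms satisfy the
`₂F₂` recurrence. -/
lemma HasSum.eq_mul_hypergeom22 {M : ℕ → ℂ} {S : ℂ} (hM : HasSum M S) (r : ℕ)
    (hsupp : ∀ n, n % 6 ≠ r → M n = 0)
    {a₁ a₂ b₁ b₂ z : ℂ} (hb₁ : ∀ m : ℕ, b₁ + m ≠ 0) (hb₂ : ∀ m : ℕ, b₂ + m ≠ 0)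
    (hT : ∀ m : ℕ, (b₁ + m) * (b₂ + m) * (m + 1) * M (6 * m + r + 6) =
      (a₁ + m) * (a₂ + m) * z * M (6 * m + r)) :
    S = M r * hypergeom22 a₁ a₂ b₁ b₂ z := by
  have hinj : Function.Injective fun m : ℕ => 6 * m + r := fun m n h => by simpa using h
  have h1 := (hinj.hasSum_iff (f := M) (a := S) fun n hn => hsupp n fun h =>
    hn ⟨n / 6, by simp only; omega⟩).2 hM
  have h2 := eq_mul_hypergeom22_term (T := M ∘ fun m : ℕ => 6 * m + r) hb₁ hb₂ fun m => by
    simpa only [Function.comp, show 6 * (m + 1) + r = 6 * m + r + 6 by ring] using hT m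
  rw [← h1.tsum_eq, hypergeom22, ← tsum_mul_left]
  refine tsum_congr fun m => ?_
  rw [h2 m]
  simp

/-- A vanishing initial term propagates through its residue class because the leading factor `D`
never vanishes. -/
lemma eq_zero_of_step_six {M : ℕ → ℂ} {κ D : ℕ → ℂ} (hD : ∀ n, D n ≠ 0)
    (hM : ∀ n, D n * M (n + 6) = κ n * M n) {r : ℕ} (h0 : ∀ n < 6, n ≠ r → M n = 0)
    (n : ℕ) (hn : n % 6 ≠ r) : M n = 0 := by
  have key : ∀ m j, M j = 0 → M (j + 6 * m) = 0 := by
    intro m j hj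
    induction m with
    | zero => exact hj
    | succ m ih =>
      have := hM (j + 6 * m)
      rw [ih, mul_zero] at this
      exact (mul_eq_zero.1 this).resolve_left (hD _)
  rw [← Nat.mod_add_div n 6]
  exact key _ _ (h0 _ (Nat.mod_lt _ (by norm_num)) hn)

section Evaluation

open PowerSeries

lemma coeff_scaledSeries_mul_zero (x y : ℝ) (ε : ℂ) :
    coeff 0 (scaledSeries (airyCoeff x y) 1 * scaledSeries (airyCoeff x y) ε) = x ^ 2 := by
  simp [coeff_mul, scaledSeries, airyCoeff]
  ring

lemma coeff_scaledSeries_mul_two (x y : ℝ) (ε : ℂ) :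
    coeff 2 (scaledSeries (airyCoeff x y) 1 * scaledSeries (airyCoeff x y) ε) = ε * y ^ 2 := by
  simp [coeff_mul, scaledSeries, airyCoeff, Finset.Nat.antidiagonal_succ]
  ring

lemma coeff_scaledSeries_mul_four {x y : ℝ} (h : x * y = 0) (ε : ℂ) :
    coeff 4 (scaledSeries (airyCoeff x y) 1 * scaledSeries (airyCoeff x y) ε) = 0 := by
  rcases mul_eq_zero.1 h with rfl | rfl <;>
    simp [coeff_mul, scaledSeries, airyCoeff, Finset.Nat.antidiagonal_succ]

variable {c : ℕ → ℝ} {F : ℂ → ℂ}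

/-- Two coefficient steps of length three meet one moment step of length six; the moment factor
`(n+1)(n+3)(n+5)` cancels the odd-shift denominators, leaving a `₂F₂` ratio. -/
lemma IsAirySeries.moment_rec (h : IsAirySeries c F) (d : ℂ) (n : ℕ) :
    ((n : ℂ) + 6) * (n + 4) * (n + 2) *
        (coeff (n + 6) (scaledSeries c 1 * scaledSeries c 1) * (2 * d) ^ (n + 6) *
          gaussMoment (n + 6)) =
      32 * d ^ 6 * (2 * n + 7) * (2 * n + 1) *
        (coeff n (scaledSeries c 1 * scaledSeries c 1) * (2 * d) ^ n * gaussMoment n) := by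
  have h1 := h.coeff_sq_add_three n
  have h2 := h.coeff_sq_add_three (n + 3)
  have h3 := eight_mul_gaussMoment_add_six n
  set A := scaledSeries c 1 * scaledSeries c 1
  push_cast at h2
  rw [show n + 3 + 3 = n + 6 by ring] at h2
  rw [pow_add]
  linear_combination (8 * d ^ 6 * (2 * d) ^ n * gaussMoment n) *
      ((n + 3) * (n + 2) * (n + 1) * h2 + (4 * n + 14) * h1) +
    (8 * d ^ 6 * (2 * d) ^ n * ((n + 6) * (n + 4) * (n + 2)) * coeff (n + 6) A) * h3

lemma IsAirySeries.moment_neg_rec (h : IsAirySeries c F) (d : ℂ) (n : ℕ) :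
    ((n : ℂ) + 6) * (n + 4) * (n + 2) *
        (coeff (n + 6) (scaledSeries c 1 * scaledSeries c (-1)) * (2 * d) ^ (n + 6) *
          gaussMoment (n + 6)) =
      -32 * d ^ 6 * (n + 3) * (n + 1) *
        (coeff n (scaledSeries c 1 * scaledSeries c (-1)) * (2 * d) ^ n * gaussMoment n) := by
  have h2 := h.coeff_mul_neg_add_six n
  have h3 := eight_mul_gaussMoment_add_six n
  set A := scaledSeries c 1 * scaledSeries c (-1)
  rw [pow_add]
  linear_combination (8 * d ^ 6 * (2 * d) ^ n * gaussMoment n) * (n + 3) * (n + 1) * h2 +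
    (8 * d ^ 6 * (2 * d) ^ n * ((n + 6) * (n + 4) * (n + 2)) * coeff (n + 6) A) * h3

lemma step_six_ne_zero (n : ℕ) : ((n : ℂ) + 6) * (n + 4) * (n + 2) ≠ 0 := by
  norm_cast

lemma third_mul_add_ne_zero (j : ℕ) (hj : j ≠ 0) (m : ℕ) : (j / 3 : ℂ) + m ≠ 0 := by
  have h : ((j + 3 * m : ℕ) : ℂ) ≠ 0 := by
    rw [Nat.cast_ne_zero]
    omega
  intro h0
  apply h
  push_cast
  linear_combination 3 * h0

/-- Odd moments vanish by parity, and the product, a series in `z³`, has no terms in `z²` or `z⁴`.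
-/
lemma moment_F_eq_zero (ε w : ℂ) : ∀ n < 6, n ≠ 0 →
    coeff n (scaledSeries (airyCoeff 1 0) 1 * scaledSeries (airyCoeff 1 0) ε) * w ^ n *
      gaussMoment n = 0 := by
  intro n hn h0
  interval_cases n
  · exact absurd rfl h0
  · simp [gaussMoment_odd]
  · simp [coeff_scaledSeries_mul_two]
  · simp [gaussMoment_odd]
  · simp [coeff_scaledSeries_mul_four]
  · simp [gaussMoment_odd]

lemma moment_G_eq_zero (ε w : ℂ) : ∀ n < 6, n ≠ 2 →
    coeff n (scaledSeries (airyCoeff 0 1) 1 * scaledSeries (airyCoeff 0 1) ε) * w ^ n *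
      gaussMoment n = 0 := by
  intro n hn h0
  interval_cases n
  · rw [coeff_scaledSeries_mul_zero]
    simp
  · simp [gaussMoment_odd]
  · exact absurd rfl h0
  · simp [gaussMoment_odd]
  · simp [coeff_scaledSeries_mul_four]
  · simp [gaussMoment_odd]

lemma moment_F_zero (ε d : ℂ) :
    coeff 0 (scaledSeries (airyCoeff 1 0) 1 * scaledSeries (airyCoeff 1 0) ε) * (2 * d) ^ 0 *
      gaussMoment 0 = √Real.pi := by
  rw [coeff_scaledSeries_mul_zero, gaussMoment_zero]
  simp

lemma moment_G_two (ε d : ℂ) :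
    coeff 2 (scaledSeries (airyCoeff 0 1) 1 * scaledSeries (airyCoeff 0 1) ε) * (2 * d) ^ 2 *
      gaussMoment 2 = 2 * (ε * d ^ 2) * √Real.pi := by
  have h := two_mul_gaussMoment_add_two 0
  rw [zero_add, gaussMoment_zero] at h
  rw [coeff_scaledSeries_mul_two]
  push_cast at h ⊢
  linear_combination 2 * ε * d ^ 2 * h

lemma integral_airyAtomF_sq (d : ℂ) :
    ∫ t : ℝ, Complex.exp (-(t : ℂ) ^ 2) *
        (airyAtomF (2 * d * t) * airyAtomF (1 * (2 * d * t))) =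
      √Real.pi * hypergeom22 (1 / 12) (7 / 12) (1 / 3) (2 / 3) (64 / 3 * d ^ 6) := by
  have hrec := isAirySeries_airyAtomF.moment_rec d
  rw [(isAirySeries_airyAtomF.hasSum_integral (ε := 1) (by simp) (2 * d)).eq_mul_hypergeom22 0
    (eq_zero_of_step_six step_six_ne_zero hrec (moment_F_eq_zero _ _))
    (a₁ := 1 / 12) (a₂ := 7 / 12) (b₁ := 1 / 3) (b₂ := 2 / 3) (z := 64 / 3 * d ^ 6)
    (by simpa using third_mul_add_ne_zero 1 one_ne_zero)
    (by simpa using third_mul_add_ne_zero 2 two_ne_zero) ?_, moment_F_zero]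
  intro m
  have := hrec (6 * m + 0)
  push_cast at this
  -- At `n = 6m`, dividing by `6³` turns `(n+2)(n+4)(n+6)` into `(m+1/3)(m+2/3)(m+1)`; the right
  -- side becomes `(64/3) d⁶ (m+1/12)(m+7/12)`.
  linear_combination (1 / 216) * this

lemma integral_airyAtomG_sq (d : ℂ) :
    ∫ t : ℝ, Complex.exp (-(t : ℂ) ^ 2) *
        (airyAtomG (2 * d * t) * airyAtomG (1 * (2 * d * t))) =
      2 * (1 * d ^ 2) * √Real.pi *
        hypergeom22 (5 / 12) (11 / 12) (2 / 3) (4 / 3) (64 / 3 * d ^ 6) := by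
  have hrec := isAirySeries_airyAtomG.moment_rec d
  rw [(isAirySeries_airyAtomG.hasSum_integral (ε := 1) (by simp) (2 * d)).eq_mul_hypergeom22 2
    (eq_zero_of_step_six step_six_ne_zero hrec (moment_G_eq_zero _ _))
    (a₁ := 5 / 12) (a₂ := 11 / 12) (b₁ := 2 / 3) (b₂ := 4 / 3) (z := 64 / 3 * d ^ 6)
    (by simpa using third_mul_add_ne_zero 2 two_ne_zero)
    (by simpa using third_mul_add_ne_zero 4 four_ne_zero) ?_, moment_G_two]
  intro m
  have := hrec (6 * m + 2)
  push_cast at this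
  linear_combination (1 / 216) * this

lemma integral_airyAtomF_mul_neg (d : ℂ) :
    ∫ t : ℝ, Complex.exp (-(t : ℂ) ^ 2) *
        (airyAtomF (2 * d * t) * airyAtomF (-1 * (2 * d * t))) =
      √Real.pi * hypergeom22 (1 / 6) (1 / 2) (1 / 3) (2 / 3) (-16 / 3 * d ^ 6) := by
  have hrec := isAirySeries_airyAtomF.moment_neg_rec d
  rw [(isAirySeries_airyAtomF.hasSum_integral (ε := -1) (by simp) (2 * d)).eq_mul_hypergeom22 0
    (eq_zero_of_step_six step_six_ne_zero hrec (moment_F_eq_zero _ _))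
    (a₁ := 1 / 6) (a₂ := 1 / 2) (b₁ := 1 / 3) (b₂ := 2 / 3) (z := -16 / 3 * d ^ 6)
    (by simpa using third_mul_add_ne_zero 1 one_ne_zero)
    (by simpa using third_mul_add_ne_zero 2 two_ne_zero) ?_, moment_F_zero]
  intro m
  have := hrec (6 * m + 0)
  push_cast at this
  linear_combination (1 / 216) * this

lemma integral_airyAtomG_mul_neg (d : ℂ) :
    ∫ t : ℝ, Complex.exp (-(t : ℂ) ^ 2) *
        (airyAtomG (2 * d * t) * airyAtomG (-1 * (2 * d * t))) =
      2 * (-1 * d ^ 2) * √Real.pi *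
        hypergeom22 (1 / 2) (5 / 6) (2 / 3) (4 / 3) (-16 / 3 * d ^ 6) := by
  have hrec := isAirySeries_airyAtomG.moment_neg_rec d
  rw [(isAirySeries_airyAtomG.hasSum_integral (ε := -1) (by simp) (2 * d)).eq_mul_hypergeom22 2
    (eq_zero_of_step_six step_six_ne_zero hrec (moment_G_eq_zero _ _))
    (a₁ := 1 / 2) (a₂ := 5 / 6) (b₁ := 2 / 3) (b₂ := 4 / 3) (z := -16 / 3 * d ^ 6)
    (by simpa using third_mul_add_ne_zero 2 two_ne_zero)
    (by simpa using third_mul_add_ne_zero 4 four_ne_zero) ?_, moment_G_two]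
  intro m
  have := hrec (6 * m + 2)
  push_cast at this
  linear_combination (1 / 216) * this

end Evaluation

/-! ### Reduction to vanishing shifts, Gamma constants and assembly. -/

lemma weightedGaussIntegral_eq (F G : ℂ → ℂ) (k a b : ℂ) :
    weightedGaussIntegral F G k a b =
      Complex.exp ((a ^ 6 + b ^ 6) / 3 - k * a ^ 2 * b ^ 2 * (a ^ 2 + b ^ 2)) *
        ∫ t : ℝ, Complex.exp (-(t : ℂ) ^ 2) *
          (F (2 * a * t + (-a ^ 4 + k * a ^ 2 * b ^ 2 - 2 * a * b ^ 3)) *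
            G (2 * b * t + (-b ^ 4 + k * a ^ 2 * b ^ 2 - 2 * a ^ 3 * b))) := by
  rw [weightedGaussIntegral, ← MeasureTheory.integral_const_mul]
  congr 1
  ext t
  ring

/-- Reduction of the shifted Gaussian integral to the diagonal (`ε = 1`) or the antidiagonal
(`ε = -1`), where the shifts vanish. -/
lemma IsAirySolution.integral_mul_eq {F F' : ℂ → ℂ} (hF : IsAirySolution F F')
    {a b d ε : ℂ} (hε : ε ^ 2 = 1) (hd : a * b = ε * d ^ 2) :
    ∫ t : ℝ, Complex.exp (-(t : ℂ) ^ 2) *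
        (F (2 * a * t + (-a ^ 4 + (1 + 2 * ε) * a ^ 2 * b ^ 2 - 2 * a * b ^ 3)) *
          F (2 * b * t + (-b ^ 4 + (1 + 2 * ε) * a ^ 2 * b ^ 2 - 2 * a ^ 3 * b))) =
      Complex.exp (-((a ^ 6 + b ^ 6) / 3 - (1 + 2 * ε) * a ^ 2 * b ^ 2 * (a ^ 2 + b ^ 2) +
          (4 * ε / 3 + 4) * (a * b) ^ 3)) *
        ∫ t : ℝ, Complex.exp (-(t : ℂ) ^ 2) * (F (2 * d * t) * F (ε * (2 * d * t))) := by
  have h := hF.weightedGaussIntegral_congr hF (k := 1 + 2 * ε)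
    (show a * b = d * (ε * d) by rw [hd]; ring)
  rw [weightedGaussIntegral_eq, weightedGaussIntegral_eq] at h
  have e1 : -d ^ 4 + (1 + 2 * ε) * d ^ 2 * (ε * d) ^ 2 - 2 * d * (ε * d) ^ 3 = 0 := by
    linear_combination d ^ 4 * hε
  have e2 : -(ε * d) ^ 4 + (1 + 2 * ε) * d ^ 2 * (ε * d) ^ 2 - 2 * d ^ 3 * (ε * d) = 0 := by
    linear_combination (2 * ε - ε ^ 2) * d ^ 4 * hε
  -- The weight at the endpoint `(d, εd)`, rewritten through `(ab)³ = ε d⁶`, so that `d` drops out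
  -- of the prefactor.
  have e3 : (d ^ 6 + (ε * d) ^ 6) / 3 -
      (1 + 2 * ε) * d ^ 2 * (ε * d) ^ 2 * (d ^ 2 + (ε * d) ^ 2) =
        -((4 * ε / 3 + 4) * (a * b) ^ 3) := by
    rw [hd]
    have h4 : ε ^ 4 = 1 := by linear_combination (ε ^ 2 + 1) * hε
    have h6 : ε ^ 6 = 1 := by linear_combination (ε ^ 4 + ε ^ 2 + 1) * hε
    linear_combination d ^ 6 * (h6 / 3 - (1 + 2 * ε) * (hε + h4) + 4 / 3 * h4 + 4 * ε * hε)
  rw [e1, e2, e3] at h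
  simp only [add_zero] at h
  have e4 : ∀ t : ℝ, F (ε * (2 * d * t)) = F (2 * (ε * d) * t) := fun t => by ring_nf
  simp only [e4]
  rw [neg_add, Complex.exp_add, mul_assoc (Complex.exp _), ← h, ← mul_assoc, ← Complex.exp_add, neg_add_cancel,
    Complex.exp_zero, one_mul]

lemma airyCross_eq (u v : ℂ) : airyCross u v = 2 * √3 *
    (airyC₁ ^ 2 * (airyAtomF u * airyAtomF v) - airyC₂ ^ 2 * (airyAtomG u * airyAtomG v)) := by
  simp only [airyCross, airyAi, airyBi]
  ring

lemma gamma_third_mul : Real.Gamma (1 / 3) * Real.Gamma (2 / 3) * 3 = 2 * √3 * √Real.pi ^ 2 := by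
  have h := Real.Gamma_mul_Gamma_one_sub (1 / 3)
  rw [show (1 : ℝ) - 1 / 3 = 2 / 3 by norm_num, show Real.pi * (1 / 3) = Real.pi / 3 by ring,
    Real.sin_pi_div_three] at h
  rw [h, Real.sq_sqrt Real.pi_pos.le]
  field_simp
  norm_num

lemma twelve_rpow : (12 : ℝ) ^ (1 / 3 : ℝ) = 3 ^ (1 / 3 : ℝ) * (2 ^ (1 / 3 : ℝ)) ^ 2 := by
  rw [show (12 : ℝ) = 3 * 2 ^ 2 by norm_num, Real.mul_rpow (by norm_num) (by norm_num),
    ← Real.rpow_natCast, ← Real.rpow_natCast, ← Real.rpow_mul (by norm_num),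
    ← Real.rpow_mul (by norm_num), mul_comm ((2 : ℕ) : ℝ)]

lemma rpow_third_pow {x : ℝ} (hx : 0 ≤ x) : (x ^ (1 / 3 : ℝ)) ^ 3 = x := by
  rw [← Real.rpow_natCast, ← Real.rpow_mul hx]
  norm_num

/-- Duplication at `1/3` expresses `Γ(5/6)` through `Γ(1/3)` and `Γ(2/3)`, and reflection removes
their product. Cube roots enter only through `x³ = 3` and `y³ = 2`. -/
lemma airyC₁_sq_mul : √3 * airyC₁ ^ 2 * √Real.pi =
    1 / ((12 : ℝ) ^ (1 / 3 : ℝ) * Real.Gamma (5 / 6)) := by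
  have hG1 : 0 < Real.Gamma (1 / 3) := Real.Gamma_pos_of_pos (by norm_num)
  have hG2 : 0 < Real.Gamma (2 / 3) := Real.Gamma_pos_of_pos (by norm_num)
  have hG : 0 < Real.Gamma (5 / 6) := Real.Gamma_pos_of_pos (by norm_num)
  have hp : 0 < √Real.pi := Real.sqrt_pos.2 Real.pi_pos
  have hx3 := rpow_third_pow (x := 3) (by norm_num)
  have hy3 := rpow_third_pow (x := 2) (by norm_num)
  have hdup := Real.Gamma_mul_Gamma_add_half (1 / 3)
  rw [show (1 : ℝ) / 3 + 1 / 2 = 5 / 6 by norm_num, show (2 : ℝ) * (1 / 3) = 2 / 3 by norm_num,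
    show (1 : ℝ) - 2 / 3 = 1 / 3 by norm_num] at hdup
  have hx : (3 : ℝ) ^ (-(2 / 3) : ℝ) = ((3 ^ (1 / 3 : ℝ)) ^ 2)⁻¹ := by
    rw [Real.rpow_neg (by norm_num), ← Real.rpow_natCast, ← Real.rpow_mul (by norm_num)]
    norm_num
  have hrefl := gamma_third_mul
  have hx0 : 0 < (3 : ℝ) ^ (1 / 3 : ℝ) := by positivity
  have hy0 : 0 < (2 : ℝ) ^ (1 / 3 : ℝ) := by positivity
  have hΓ : Real.Gamma (5 / 6) = Real.Gamma (2 / 3) * 2 ^ (1 / 3 : ℝ) * √Real.pi /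
      Real.Gamma (1 / 3) := by
    rw [eq_div_iff hG1.ne']
    linear_combination hdup
  rw [twelve_rpow, airyC₁, hx, hΓ]
  set x := (3 : ℝ) ^ (1 / 3 : ℝ)
  set y := (2 : ℝ) ^ (1 / 3 : ℝ)
  field_simp
  rw [hx3, hy3]
  linear_combination -hrefl

/-- The same argument with duplication at `2/3` and `Γ(4/3) = Γ(1/3) / 3`. -/
lemma airyC₂_sq_mul : √3 * airyC₂ ^ 2 * √Real.pi =
    1 / ((12 : ℝ) ^ (1 / 3 : ℝ) * ((12 : ℝ) ^ (1 / 3 : ℝ) * Real.Gamma (7 / 6))) := by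
  have hG1 : 0 < Real.Gamma (1 / 3) := Real.Gamma_pos_of_pos (by norm_num)
  have hG2 : 0 < Real.Gamma (2 / 3) := Real.Gamma_pos_of_pos (by norm_num)
  have hG : 0 < Real.Gamma (7 / 6) := Real.Gamma_pos_of_pos (by norm_num)
  have hp : 0 < √Real.pi := Real.sqrt_pos.2 Real.pi_pos
  have hy3 := rpow_third_pow (x := 2) (by norm_num)
  have hdup := Real.Gamma_mul_Gamma_add_half (2 / 3)
  rw [show (2 : ℝ) / 3 + 1 / 2 = 7 / 6 by norm_num, show (2 : ℝ) * (2 / 3) = 1 / 3 + 1 by norm_num,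
    show (1 : ℝ) - (1 / 3 + 1) = -(1 / 3) by norm_num, Real.Gamma_add_one (by norm_num),
    Real.rpow_neg (by norm_num)] at hdup
  have hx : (3 : ℝ) ^ (-(1 / 3) : ℝ) = (3 ^ (1 / 3 : ℝ))⁻¹ := Real.rpow_neg (by norm_num) _
  have hrefl := gamma_third_mul
  have hx0 : 0 < (3 : ℝ) ^ (1 / 3 : ℝ) := by positivity
  have hy0 : 0 < (2 : ℝ) ^ (1 / 3 : ℝ) := by positivity
  have hΓ : Real.Gamma (7 / 6) = 1 / 3 * Real.Gamma (1 / 3) * (2 ^ (1 / 3 : ℝ))⁻¹ * √Real.pi /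
      Real.Gamma (2 / 3) := by
    rw [eq_div_iff hG2.ne']
    linear_combination hdup
  rw [twelve_rpow, airyC₂, hx, hΓ]
  set x := (3 : ℝ) ^ (1 / 3 : ℝ)
  set y := (2 : ℝ) ^ (1 / 3 : ℝ)
  field_simp
  rw [hy3]
  linear_combination -hrefl

lemma integrable_airyCross (a p b q : ℂ) : MeasureTheory.Integrable fun t : ℝ =>
    Complex.exp (-(t : ℂ) ^ 2) * airyCross (a * t + p) (b * t + q) := by
  obtain ⟨F', hF⟩ := isAirySeries_airyAtomF.exists_isAirySolution
  obtain ⟨G', hG⟩ := isAirySeries_airyAtomG.exists_isAirySolution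
  refine ((((hF.subGaussian.integrable_mul hF.continuous hF.subGaussian hF.continuous
    a p b q).const_mul (airyC₁ ^ 2 : ℂ)).sub ((hG.subGaussian.integrable_mul hG.continuous
    hG.subGaussian hG.continuous a p b q).const_mul (airyC₂ ^ 2 : ℂ))).const_mul
    (2 * √3 : ℂ)).congr (.of_forall fun t => ?_)
  simp only [airyCross_eq, Pi.sub_apply]
  ring

lemma integral_airyCross (a p b q : ℂ) :
    ∫ t : ℝ, Complex.exp (-(t : ℂ) ^ 2) * airyCross (a * t + p) (b * t + q) =
      2 * √3 * (airyC₁ ^ 2 * (∫ t : ℝ, Complex.exp (-(t : ℂ) ^ 2) *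
          (airyAtomF (a * t + p) * airyAtomF (b * t + q))) -
        airyC₂ ^ 2 * ∫ t : ℝ, Complex.exp (-(t : ℂ) ^ 2) *
          (airyAtomG (a * t + p) * airyAtomG (b * t + q))) := by
  obtain ⟨F', hF⟩ := isAirySeries_airyAtomF.exists_isAirySolution
  obtain ⟨G', hG⟩ := isAirySeries_airyAtomG.exists_isAirySolution
  rw [← MeasureTheory.integral_const_mul, ← MeasureTheory.integral_const_mul,
    ← MeasureTheory.integral_sub, ← MeasureTheory.integral_const_mul]
  · congr 1
    ext t
    rw [airyCross_eq]
    ring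
  · exact (hF.subGaussian.integrable_mul hF.continuous hF.subGaussian hF.continuous
      a p b q).const_mul _
  · exact (hG.subGaussian.integrable_mul hG.continuous hG.subGaussian hG.continuous
      a p b q).const_mul _

/-- The Gaussian integral of the Airy cross product for both families of shifts:
`ε = 1` and `ε = -1`. -/
lemma integral_airyCross_eq {a b d ε H₁ H₂ : ℂ} (hε : ε ^ 2 = 1) (hd : a * b = ε * d ^ 2)
    (h₁ : ∫ t : ℝ, Complex.exp (-(t : ℂ) ^ 2) *
      (airyAtomF (2 * d * t) * airyAtomF (ε * (2 * d * t))) = √Real.pi * H₁)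
    (h₂ : ∫ t : ℝ, Complex.exp (-(t : ℂ) ^ 2) *
      (airyAtomG (2 * d * t) * airyAtomG (ε * (2 * d * t))) =
        2 * (ε * d ^ 2) * √Real.pi * H₂) :
    ∫ t : ℝ, Complex.exp (-(t : ℂ) ^ 2) *
        airyCross (2 * a * t + (-a ^ 4 + (1 + 2 * ε) * a ^ 2 * b ^ 2 - 2 * a * b ^ 3))
          (2 * b * t + (-b ^ 4 + (1 + 2 * ε) * a ^ 2 * b ^ 2 - 2 * a ^ 3 * b)) =
      2 / ((12 : ℝ) ^ (1 / 3 : ℝ) : ℝ) *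
        Complex.exp (-((a ^ 6 + b ^ 6) / 3 - (1 + 2 * ε) * a ^ 2 * b ^ 2 * (a ^ 2 + b ^ 2) +
          (4 * ε / 3 + 4) * (a * b) ^ 3)) *
        (1 / (Real.Gamma (5 / 6) : ℂ) * H₁ -
          2 * a * b / (((12 : ℝ) ^ (1 / 3 : ℝ) : ℝ) * (Real.Gamma (7 / 6) : ℂ)) * H₂) := by
  obtain ⟨F', hF⟩ := isAirySeries_airyAtomF.exists_isAirySolution
  obtain ⟨G', hG⟩ := isAirySeries_airyAtomG.exists_isAirySolution
  rw [integral_airyCross, hF.integral_mul_eq hε hd, hG.integral_mul_eq hε hd, h₁, h₂, ← hd]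
  have k₁ := congrArg (fun x : ℝ => (x : ℂ)) airyC₁_sq_mul
  have k₂ := congrArg (fun x : ℝ => (x : ℂ)) airyC₂_sq_mul
  simp only [div_eq_mul_inv, one_mul, mul_inv, Complex.ofReal_mul, Complex.ofReal_pow,
    Complex.ofReal_inv] at k₁ k₂
  simp only [div_eq_mul_inv, mul_inv, one_mul]
  set E := Complex.exp _
  linear_combination (2 * E * H₁) * k₁ - (4 * a * b * E * H₂) * k₂

theorem mainTheorem6 (a b : ℂ) :
    (MeasureTheory.Integrable (fun t : ℝ => Complex.exp (-(t : ℂ) ^ 2) *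
        airyCross (2 * a * t - a * (a - b) ^ 2 * (a + 2 * b))
          (2 * b * t - b * (a - b) ^ 2 * (2 * a + b))) ∧
      ∫ t : ℝ, Complex.exp (-(t : ℂ) ^ 2) *
        airyCross (2 * a * t - a * (a - b) ^ 2 * (a + 2 * b))
          (2 * b * t - b * (a - b) ^ 2 * (2 * a + b)) =
      2 / ((12 : ℝ) ^ (1 / 3 : ℝ) : ℝ) *
        Complex.exp (-(1 / 3) * ((a - b) ^ 4 * (a ^ 2 + 4 * a * b + b ^ 2))) *
        (1 / (Real.Gamma (5 / 6) : ℂ) *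
            hypergeom22 (1 / 12) (7 / 12) (1 / 3) (2 / 3) (64 / 3 * (a * b) ^ 3) -
          2 * a * b / (((12 : ℝ) ^ (1 / 3 : ℝ) : ℝ) * (Real.Gamma (7 / 6) : ℂ)) *
            hypergeom22 (5 / 12) (11 / 12) (2 / 3) (4 / 3) (64 / 3 * (a * b) ^ 3))) ∧
    (MeasureTheory.Integrable (fun t : ℝ => Complex.exp (-(t : ℂ) ^ 2) *
        airyCross (2 * a * t - a * (a + b) * (a ^ 2 - a * b + 2 * b ^ 2))
          (2 * b * t - b * (a + b) * (2 * a ^ 2 - a * b + b ^ 2))) ∧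
      ∫ t : ℝ, Complex.exp (-(t : ℂ) ^ 2) *
        airyCross (2 * a * t - a * (a + b) * (a ^ 2 - a * b + 2 * b ^ 2))
          (2 * b * t - b * (a + b) * (2 * a ^ 2 - a * b + b ^ 2)) =
      2 / ((12 : ℝ) ^ (1 / 3 : ℝ) : ℝ) *
        Complex.exp (-(1 / 3) *
          ((a ^ 3 + b ^ 3) ^ 2 + 3 * a ^ 2 * b ^ 2 * (a + b) ^ 2)) *
        (1 / (Real.Gamma (5 / 6) : ℂ) *
            hypergeom22 (1 / 6) (1 / 2) (1 / 3) (2 / 3) (16 / 3 * (a * b) ^ 3) -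
          2 * a * b / (((12 : ℝ) ^ (1 / 3 : ℝ) : ℝ) * (Real.Gamma (7 / 6) : ℂ)) *
            hypergeom22 (1 / 2) (5 / 6) (2 / 3) (4 / 3) (16 / 3 * (a * b) ^ 3))) := by
  refine ⟨⟨?_, ?_⟩, ?_, ?_⟩
  · refine (integrable_airyCross (2 * a) (-(a * (a - b) ^ 2 * (a + 2 * b))) (2 * b)
      (-(b * (a - b) ^ 2 * (2 * a + b)))).congr (.of_forall fun t => ?_)
    simp only [sub_eq_add_neg]
  -- Either square root serves: the result involves `d` only through `d² = ab`.
  · obtain ⟨d, hd⟩ := IsAlgClosed.exists_pow_nat_eq (a * b) two_pos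
    have h6 : d ^ 6 = (a * b) ^ 3 := by rw [← hd]; ring
    have h := integral_airyCross_eq (a := a) (b := b) (ε := 1) (by norm_num)
      (by rw [hd, one_mul]) (integral_airyAtomF_sq d) (integral_airyAtomG_sq d)
    rw [h6] at h
    convert h using 4 <;> ring_nf
  · refine (integrable_airyCross (2 * a) (-(a * (a + b) * (a ^ 2 - a * b + 2 * b ^ 2))) (2 * b)
      (-(b * (a + b) * (2 * a ^ 2 - a * b + b ^ 2)))).congr (.of_forall fun t => ?_)
    simp only [sub_eq_add_neg]
  -- With `ε = -1` the requirement `ab = ε d²` makes `d⁶ = -(ab)³`, which turns the argument `-16/3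
  -- d⁶` positive in `(ab)³`.
  · obtain ⟨d, hd⟩ := IsAlgClosed.exists_pow_nat_eq (-(a * b)) two_pos
    have h6 : -16 / 3 * d ^ 6 = 16 / 3 * (a * b) ^ 3 := by
      linear_combination (-16 / 3 * (d ^ 4 - d ^ 2 * (a * b) + (a * b) ^ 2)) * hd
    have h := integral_airyCross_eq (a := a) (b := b) (ε := -1) (by norm_num)
      (by rw [hd]; ring) (integral_airyAtomF_mul_neg d) (integral_airyAtomG_mul_neg d)
    rw [h6] at h
    convert h using 4 <;> ring_nf
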